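/- **Setting.** Let $X,Y,Z$ be real locally convex Hausdorff topological vector spaces. Let $K\subsetneq Y$ be a closed convex cone with $\operatorname{int}K\neq\emptyset$, let $S\subset Z$ be a nonempty closed convex cone, let $\mathcal U$ be a nonempty set, and let $C\subset X$. Put $Y^\bullet=Y\cup\{\pm\infty_Y\}$ and $Z^\bullet=Z\cup\{\pm\infty_Z\}$, with $\pm\infty$ absorbing in sums with finite elements. Write $a<_Kb$ for $a-b\in-\operatorname{int}K$ when $a,b\in Y$, and let $-\infty_Y<_Ky<_K+\infty_Y$ for $y\in Y$. Let $\mathcal L(X,Y)$ be the space of continuous linear mappings $X\to Y$ with the topology of pointwise convergence, and let $\emptyset\ne\mathcal V\subset\mathcal L(X,Y)$. For $M\subset Y^\bullet$, let $\operatorname{winf}M$ be the set of all $\bar v\in Y^\bullet$ such that no $v\in M$ satisfies $v<_K\bar v$ and such that for each $\tilde v\in Y^\bullet$ with $\bar v<_K\tilde v$ there is $v\in M$ with $v<_K\tilde v$. Let $\operatorname{wsup}M$ be defined in the same way with $<_K$ reversed, and let $\operatorname{wmax}M=M\cap\operatorname{wsup}M$. (So $\operatorname{winf}\emptyset=\{+\infty_Y\}$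 and $\operatorname{wsup}\emptyset=\{-\infty_Y\}$.) A mapping $H:X\to Y^\bullet$ is proper if it never takes the value $-\infty_Y$ and $\operatorname{dom}H=\{x:H(x)\ne+\infty_Y\}$ is nonempty. Put $\operatorname{epi}H=\{(x,y)\in X\times Y: y\in H(x)+K\}$. $H$ is $K$-convex (resp. $K$-epi closed) if $\operatorname{epi}H$ is convex (resp. closed). $H$ is positively $K$-lsc if $y^*\circ H$ is lower semicontinuous for every nonzero continuous linear functional $y^*$ on $Y$ that is nonnegative on $K$, where $y^*(\pm\infty_Y)=\pm\infty$. The same terms are used for $Z,S$ in place of $Y,K$. Put $H^*(L)=\operatorname{wsup}\{L(x)-H(x):x\in X\}$ for $L\in\mathcal L(X,Y)$ and $\operatorname{epi}H^*=\{(L,y)\in\mathcal L(X,Y)\times Y: y\in H^*(L)+K\}$. The indicator mapping $I_D$ is $0_Y$ on $D$ and $+\infty_Y$ off $D$ (for $D\subset X$ or $D\subset Z$). For linear $T:Z\to Y$ and $G:X\to Z^\bullet$, $(T\circ G)(x)=T(G(x))$ if $G(x)\in Z$, and $+\infty_Y$ if $G(x)=+\infty_Z$. Let $F:X\to Y^\bullet$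 and $G_u:X\to Z^\bullet$ $(u\in\mathcal U)$ be proper, let $A=\{x\in C: G_u(x)\in-S\ \ \forall u\in\mathcal U\}$, and assume $A\cap\operatorname{dom}F\ne\emptyset$. Put $$\mathcal L_+(S,K)=\{T\in\mathcal L(Z,Y):T(S)\subset K\},\qquad \mathcal L^w_+(S,K)=\{T\in\mathcal L(Z,Y):T(S)\cap(-\operatorname{int}K)=\emptyset\},$$ $$\mathcal A=\bigcup_{T\in\mathcal L_+(S,K),\,u\in\mathcal U}\operatorname{epi}(F+I_C+T\circ G_u)^*,$$ $$\mathcal B=\bigcup_{T\in\mathcal L^w_+(S,K),\,u\in\mathcal U}\ \bigcap_{v\in I^*_{-S}(T)}\bigl[\operatorname{epi}(F+I_C+T\circ G_u)^*+(0,v)\bigr],$$ where $I_{-S}^*(T)=\operatorname{wsup}\{T(z):z\in-S\}$ is the conjugate of $I_{-S}$ at $T$. For $k\in Y$ let $E_k=\{(x\mapsto x^*(x)k,\;rk): x^*\in X^*,\ r\in\mathbb R\}\subset\mathcal L(X,Y)\times Y$. A set $N\subset\mathcal L(X,Y)\times Y$ is $k$-sectionally convex if $N\cap(E_k+e)$ is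 convex for every $e\in\mathcal L(X,Y)\times Y$; $\operatorname{sco}_kN$ is the smallest $k$-sectionally convex set containing $N$. We say that $N$ is $k$-sectionally convex and closed regarding $\mathcal V\times Y$ if $\operatorname{cl}(\operatorname{sco}_kN)\cap(\mathcal V\times Y)=N\cap(\mathcal V\times Y)$. For $L\in\mathcal L(X,Y)$ put $$\operatorname{winf}(\mathrm{RVP}^L)=\operatorname{winf}\{F(x)-L(x):x\in A\},$$ $$\operatorname{wmax}(\mathrm{RVD}^L)=\operatorname{wmax}\bigcup_{T\in\mathcal L_+(S,K),\,u\in\mathcal U}\operatorname{winf}\{F(x)-L(x)+(T\circ G_u)(x):x\in C\},$$ $$\operatorname{wmax}(\mathrm{RVD}^L_w)=\operatorname{wmax}\bigcup_{T\in\mathcal L^w_+(S,K),\,u\in\mathcal U}\operatorname{winf}\{F(x)-L(x)+(T\circ G_u)(x)+T(s):x\in C,\ s\in S\}.$$ Robust strong $\mathcal V$-stable duality holds for (RVP)–(RVD) if $\operatorname{wmax}(\mathrm{RVD}^L)=\operatorname{winf}(\mathrm{RVP}^L)$ for all $L\in\mathcal V$, and for (RVP)–(RVD$_w$) if $\operatorname{wmax}(\mathrm{RVD}_w^L)=\operatorname{winf}(\mathrm{RVP}^L)$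 for all $L\in\mathcal V$. **Theorem.** Assume $(\mathcal H_0)$: $F$ is $K$-convex and positively $K$-lsc; $G_u$ is $S$-convex and $S$-epi closed for every $u\in\mathcal U$; $C$ is nonempty, closed and convex. Then: 1. there is $k\in\operatorname{int}K$ such that $\mathcal A$ is $k$-sectionally convex and closed regarding $\mathcal V\times Y$ if and only if robust strong $\mathcal V$-stable duality holds for (RVP)–(RVD); 2. there is $k\in\operatorname{int}K$ such that $\mathcal B$ is $k$-sectionally convex and closed regarding $\mathcal V\times Y$ if and only if robust strong $\mathcal V$-stable duality holds for (RVP)–(RVD$_w$). -/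

import Mathlib

namespace RobustVector

noncomputable section

/-! ### The extended space `Y ∪ {-∞, +∞}` -/

/-- A vector space with a smallest element `-∞` and a greatest element `+∞` attached. -/
inductive Ext (Y : Type*) where
  | negInf : Ext Y
  | fin : Y → Ext Y
  | posInf : Ext Y

namespace Ext

variable {Y Z : Type*}

instance : Coe Y (Ext Y) := ⟨fin⟩

/-- Negation, exchanging the two infinite elements. -/
protected def neg [Neg Y] : Ext Y → Ext Y
  | negInf => posInf
  | fin y => fin (-y)
  | posInf => negInf

/-- Addition, with both infinite elements absorbing. The sum of `-∞` and `+∞` is left undefined in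
the theory; it is given the value `+∞` here, and does not occur for proper mappings. -/
protected def add [Add Y] : Ext Y → Ext Y → Ext Y
  | posInf, _ => posInf
  | _, posInf => posInf
  | negInf, _ => negInf
  | _, negInf => negInf
  | fin y, fin y' => fin (y + y')

instance [Neg Y] : Neg (Ext Y) := ⟨Ext.neg⟩
instance [Add Y] : Add (Ext Y) := ⟨Ext.add⟩
instance [Neg Y] [Add Y] : Sub (Ext Y) := ⟨fun a b => a + -b⟩

/-- Apply a map `T : Z → Y` to an extended element (`T (±∞) = ±∞`). -/
def map (T : Z → Y) : Ext Z → Ext Y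
  | negInf => negInf
  | fin z => fin (T z)
  | posInf => posInf

/-- Apply a scalar function `φ : Y → ℝ` to an extended element (`φ (±∞) = ±∞`). -/
def toEReal (φ : Y → ℝ) : Ext Y → EReal
  | negInf => ⊥
  | fin y => (φ y : EReal)
  | posInf => ⊤

end Ext

/-! ### Weak ordering, weak infima and suprema -/

section Order

variable {Y : Type*} [AddCommGroup Y] [Module ℝ Y] [TopologicalSpace Y]

/-- The weak ordering `a <_K b`: for `a, b ∈ Y` it means `a - b ∈ -int K`, and
`-∞ <_K y <_K +∞` for `y ∈ Y` (also `-∞ <_K +∞`). -/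
def wlt (K : ProperCone ℝ Y) : Ext Y → Ext Y → Prop
  | .negInf, .negInf => False
  | .negInf, .fin _ => True
  | .negInf, .posInf => True
  | .fin a, .fin b => -(a - b) ∈ interior (K : Set Y)
  | .fin _, .posInf => True
  | .fin _, .negInf => False
  | .posInf, _ => False

/-- The weak infimum of `M`. For `M = ∅` this is `{+∞}`. -/
def winf (K : ProperCone ℝ Y) (M : Set (Ext Y)) : Set (Ext Y) :=
  {v | (∀ w ∈ M, ¬ wlt K w v) ∧ ∀ v', wlt K v v' → ∃ w ∈ M, wlt K w v'}

/-- The weak supremum of `M`. For `M = ∅` this is `{-∞}`. -/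
def wsup (K : ProperCone ℝ Y) (M : Set (Ext Y)) : Set (Ext Y) :=
  {v | (∀ w ∈ M, ¬ wlt K v w) ∧ ∀ v', wlt K v' v → ∃ w ∈ M, wlt K v' w}

/-- The weak maximum of `M`. -/
def wmax (K : ProperCone ℝ Y) (M : Set (Ext Y)) : Set (Ext Y) := M ∩ wsup K M

/-- The dual cone `K⁺`. -/
def dualCone (K : ProperCone ℝ Y) : Set (Y →L[ℝ] ℝ) := {φ | ∀ y ∈ K, 0 ≤ φ y}

end Order

/-! ### Extended vector-valued mappings -/

section Mappings

variable {X Y : Type*} [AddCommGroup X] [Module ℝ X] [TopologicalSpace X]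
  [AddCommGroup Y] [Module ℝ Y] [TopologicalSpace Y]

/-- The effective domain. -/
def dom (F : X → Ext Y) : Set X := {x | F x ≠ .posInf}

/-- Properness. -/
def IsProper (F : X → Ext Y) : Prop := (dom F).Nonempty ∧ ∀ x, F x ≠ .negInf

/-- The `K`-epigraph `{(x, y) | y ∈ F(x) + K}`. -/
def epi (K : ProperCone ℝ Y) (F : X → Ext Y) : Set (X × Y) :=
  {p | ∃ k ∈ K, (p.2 : Ext Y) = F p.1 + (k : Ext Y)}

/-- `K`-convexity. -/
def IsConvexMap (K : ProperCone ℝ Y) (F : X → Ext Y) : Prop := Convex ℝ (epi K F)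

/-- `K`-epi closedness. -/
def IsEpiClosed (K : ProperCone ℝ Y) (F : X → Ext Y) : Prop := IsClosed (epi K F)

/-- Positive `K`-lower semicontinuity: `y* ∘ F` is lsc for all nonzero `y* ∈ K⁺`. -/
def IsPositivelyLsc (K : ProperCone ℝ Y) (F : X → Ext Y) : Prop :=
  ∀ φ ∈ dualCone K, φ ≠ 0 → LowerSemicontinuous fun x => (F x).toEReal φ

open Classical in
/-- The indicator mapping of a set. -/
def indicator (D : Set X) : X → Ext Y := fun x => if x ∈ D then ((0 : Y) : Ext Y) else .posInf

variable [IsTopologicalAddGroup Y]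

/-- The conjugate mapping. Here and below `X →Lₚₜ[ℝ] Y` is the space of continuous linear mappings
with the topology of pointwise convergence. -/
def conj (K : ProperCone ℝ Y) (F : X → Ext Y) (L : X →Lₚₜ[ℝ] Y) : Set (Ext Y) :=
  wsup K (Set.range fun x => (L x : Ext Y) - F x)

/-- The `K`-epigraph of the conjugate, `{(L, y) | y ∈ F*(L) + K}`. -/
def epiConj (K : ProperCone ℝ Y) (F : X → Ext Y) : Set ((X →Lₚₜ[ℝ] Y) × Y) :=
  {p | ∃ w ∈ conj K F p.1, ∃ k ∈ K, (p.2 : Ext Y) = w + (k : Ext Y)}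

end Mappings

/-! ### Sectional convexity -/

section Sectional

variable {E : Type*} [AddCommGroup E] [Module ℝ E]

/-- `N` is `E₀`-sectionally convex: `N ∩ (E₀ + v)` is convex for all `v`. -/
def SectionallyConvex (E₀ : Set E) (N : Set E) : Prop :=
  ∀ v : E, Convex ℝ (N ∩ (fun e => e + v) '' E₀)

/-- The `E₀`-sectionally convex hull. -/
def sco (E₀ : Set E) (N : Set E) : Set E := ⋂₀ {M | SectionallyConvex E₀ M ∧ N ⊆ M}

variable {X Y : Type*} [AddCommGroup X] [Module ℝ X] [TopologicalSpace X]
  [AddCommGroup Y] [Module ℝ Y] [TopologicalSpace Y] [IsTopologicalAddGroup Y]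
  [ContinuousSMul ℝ Y]

/-- The mapping `k · x* : x ↦ ⟨x*, x⟩ k`. -/
def kmul (k : Y) (φ : X →L[ℝ] ℝ) : X →Lₚₜ[ℝ] Y :=
  ContinuousLinearMap.toUniformConvergenceCLM (RingHom.id ℝ) Y _ (φ.smulRight k)

/-- The subspace `E_k = {(k · x*, r k) | x* ∈ X*, r ∈ ℝ}`. -/
def kSubspace (X : Type*) [AddCommGroup X] [Module ℝ X] [TopologicalSpace X] (k : Y) :
    Set ((X →Lₚₜ[ℝ] Y) × Y) :=
  {p | ∃ (φ : X →L[ℝ] ℝ) (r : ℝ), p = (kmul k φ, r • k)}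

/-- `N` is `k`-sectionally convex and closed regarding `W`: the closure of its `k`-sectionally
convex hull agrees with `N` on `W`. -/
def SectionallyConvexClosedRegarding (k : Y) (N W : Set ((X →Lₚₜ[ℝ] Y) × Y)) : Prop :=
  closure (sco (kSubspace X k) N) ∩ W = N ∩ W

end Sectional

/-! ### The robust vector problem, its qualifying sets and its duals -/

section Problem

variable {X Y Z U : Type*}
  [AddCommGroup X] [Module ℝ X] [TopologicalSpace X]
  [AddCommGroup Y] [Module ℝ Y] [TopologicalSpace Y] [IsTopologicalAddGroup Y]
  [AddCommGroup Z] [Module ℝ Z] [TopologicalSpace Z]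

/-- The feasible set `{x ∈ C | G_u(x) ∈ -S for all u}`. -/
def feasible (S : ProperCone ℝ Z) (C : Set X) (G : U → X → Ext Z) : Set X :=
  {x | x ∈ C ∧ ∀ u, ∃ s ∈ S, G u x = ((-s : Z) : Ext Z)}

/-- The cone of positive operators. -/
def posOp (S : ProperCone ℝ Z) (K : ProperCone ℝ Y) : Set (Z →Lₚₜ[ℝ] Y) :=
  {T | ∀ s ∈ S, T s ∈ K}

/-- The cone of weakly positive operators: `T(S) ∩ (-int K) = ∅`. -/
def weakPosOp (S : ProperCone ℝ Z) (K : ProperCone ℝ Y) : Set (Z →Lₚₜ[ℝ] Y) :=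
  {T | ∀ s ∈ S, -(T s) ∉ interior (K : Set Y)}

/-- The mapping `F + I_C + T ∘ G_u`. -/
def lagrangian (C : Set X) (F : X → Ext Y) (g : X → Ext Z) (T : Z →Lₚₜ[ℝ] Y) : X → Ext Y :=
  fun x => F x + indicator C x + (g x).map T

/-- The qualifying set `𝒜`. -/
def qualA (K : ProperCone ℝ Y) (S : ProperCone ℝ Z) (C : Set X) (F : X → Ext Y)
    (G : U → X → Ext Z) : Set ((X →Lₚₜ[ℝ] Y) × Y) :=
  ⋃ T ∈ posOp S K, ⋃ u : U, epiConj K (lagrangian C F (G u) T)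

/-- The weak qualifying set `ℬ`; `conj K (indicator (-S)) T` is the value `I*_{-S}(T)` of the
conjugate of the indicator mapping of `-S`. -/
def qualB (K : ProperCone ℝ Y) (S : ProperCone ℝ Z) (C : Set X) (F : X → Ext Y)
    (G : U → X → Ext Z) : Set ((X →Lₚₜ[ℝ] Y) × Y) :=
  ⋃ T ∈ weakPosOp S K, ⋃ u : U,
    ⋂ v ∈ {v : Y | (v : Ext Y) ∈ conj K (indicator {z : Z | -z ∈ S}) T},
      (fun p : (X →Lₚₜ[ℝ] Y) × Y => p + (0, v)) '' epiConj K (lagrangian C F (G u) T)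

/-- The perturbed objective `F - L`. -/
def perturb (F : X → Ext Y) (L : X →Lₚₜ[ℝ] Y) : X → Ext Y := fun x => F x - (L x : Ext Y)

/-- The weak infimum of the robust problem `min {F(x) | x ∈ C, G_u(x) ∈ -S for all u}`. -/
def winfPrimal (K : ProperCone ℝ Y) (S : ProperCone ℝ Z) (C : Set X) (F : X → Ext Y)
    (G : U → X → Ext Z) : Set (Ext Y) :=
  winf K (F '' feasible S C G)

/-- The weak maximum of the Lagrangian robust dual problem: the set maximized is the union over
`(T, u) ∈ ℒ₊(S, K) × 𝒰` of the sets `winf {F(x) + T(G_u(x)) | x ∈ C}`. -/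
def wmaxDual (K : ProperCone ℝ Y) (S : ProperCone ℝ Z) (C : Set X) (F : X → Ext Y)
    (G : U → X → Ext Z) : Set (Ext Y) :=
  wmax K (⋃ T ∈ posOp S K, ⋃ u : U, winf K ((fun x => F x + (G u x).map T) '' C))

/-- The weak maximum of the weak Lagrangian robust dual problem: the set maximized is the union
over `(T, u) ∈ ℒ₊ʷ(S, K) × 𝒰` of the sets `winf {F(x) + T(G_u(x)) + T(s) | x ∈ C, s ∈ S}`. -/
def wmaxWeakDual (K : ProperCone ℝ Y) (S : ProperCone ℝ Z) (C : Set X) (F : X → Ext Y)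
    (G : U → X → Ext Z) : Set (Ext Y) :=
  wmax K (⋃ T ∈ weakPosOp S K, ⋃ u : U,
    winf K ((fun p : X × Z => F p.1 + (G u p.1).map T + ((T p.2 : Y) : Ext Y)) ''
      (C ×ˢ (S : Set Z))))

/-- Robust strong `𝒱`-stable duality for the robust problem and its Lagrangian dual. -/
def StrongStableDuality (K : ProperCone ℝ Y) (S : ProperCone ℝ Z) (C : Set X) (F : X → Ext Y)
    (G : U → X → Ext Z) (V : Set (X →Lₚₜ[ℝ] Y)) : Prop :=
  ∀ L ∈ V, wmaxDual K S C (perturb F L) G = winfPrimal K S C (perturb F L) G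

/-- Robust strong `𝒱`-stable duality for the robust problem and its weak Lagrangian dual. -/
def WeakStrongStableDuality (K : ProperCone ℝ Y) (S : ProperCone ℝ Z) (C : Set X)
    (F : X → Ext Y) (G : U → X → Ext Z) (V : Set (X →Lₚₜ[ℝ] Y)) : Prop :=
  ∀ L ∈ V, wmaxWeakDual K S C (perturb F L) G = winfPrimal K S C (perturb F L) G

/-- The convexity hypothesis on the data. -/
structure ConvexData (K : ProperCone ℝ Y) (S : ProperCone ℝ Z) (C : Set X) (F : X → Ext Y)
    (G : U → X → Ext Z) : Prop where
  convex_F : IsConvexMap K F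
  lsc_F : IsPositivelyLsc K F
  convex_G : ∀ u, IsConvexMap S (G u)
  epiClosed_G : ∀ u, IsEpiClosed S (G u)
  nonempty_C : C.Nonempty
  closed_C : IsClosed C
  convex_C : Convex ℝ C

end Problem

end

end RobustVector

/-! Everything is compared with `feasEpiConj`, the set of pairs (L, y) for which -y is a weak lower
bound of F - L on the feasible set A. It depends neither on k nor on the multipliers, and it
contains ℬ, which contains 𝒜.

Duality side: an order-theoretic argument (`wmax_eq_winf_iff`) shows that strong duality at L holds
exactly when each finite weak lower bound of the primal is already a weak lower bound of one
Lagrangian. Hence stable duality on V says that 𝒜 (resp. ℬ) agrees with `feasEpiConj` on V × Y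
(`strongStableDuality_iff`, `weakStrongStableDuality_iff`).

Closure side: for every k in int K the closure of the k-sectionally convex hull of 𝒜, hence also of
ℬ, equals `feasEpiConj`. That set is closed and k-sectionally convex, which gives one inclusion. For
the other (`feasEpiConj_subset_closure_sco`), Hahn–Banach yields φ in the dual cone with φ(k) = 1
that turns the vector inequality at (L, y) into a scalar one. Scalar robust duality
(`mem_closure_convexHull_minorants`) places (φ ∘ L, φ y) in the weak* closed convex hull of scalar
Lagrangian minorants, and the affine map `sectionMap` carries these into 𝒜, a scalar multiplier ζ
becoming the operator -ζ k.

So both conditions express the same equality on V × Y, whichever k is used. -/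

set_option linter.unusedSectionVars false

namespace RobustVector

noncomputable section

/-! ### Interior of a convex cone -/

section Cone

variable {Y : Type*} [AddCommGroup Y] [Module ℝ Y] [TopologicalSpace Y] [IsTopologicalAddGroup Y]
  [ContinuousSMul ℝ Y] {K : ProperCone ℝ Y}

lemma add_mem_interior_cone {a b : Y} (ha : a ∈ K) (hb : b ∈ interior (K : Set Y)) :
    a + b ∈ interior (K : Set Y) := by
  refine mem_interior.2 ⟨(fun x => a + x) '' interior (K : Set Y), ?_,
    (isOpenMap_add_left a) _ isOpen_interior, ⟨b, hb, rfl⟩⟩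
  rintro _ ⟨x, hx, rfl⟩
  exact K.add_mem ha (interior_subset hx)

lemma smul_mem_interior_cone {t : ℝ} (ht : 0 < t) {b : Y} (hb : b ∈ interior (K : Set Y)) :
    t • b ∈ interior (K : Set Y) := by
  refine mem_interior.2 ⟨(fun x => t • x) '' interior (K : Set Y), ?_,
    (isOpenMap_smul₀ ht.ne') _ isOpen_interior, ⟨b, hb, rfl⟩⟩
  rintro _ ⟨x, hx, rfl⟩
  exact K.smul_mem (interior_subset hx) ht.le

lemma exists_pos_add_smul_mem_interior {a : Y} (ha : a ∈ interior (K : Set Y)) (b : Y) :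
    ∃ ε : ℝ, 0 < ε ∧ a + ε • b ∈ interior (K : Set Y) := by
  have hc : Continuous fun ε : ℝ => a + ε • b := by fun_prop
  have h0 : ∀ᶠ ε : ℝ in nhds 0, a + ε • b ∈ interior (K : Set Y) :=
    hc.continuousAt.eventually (isOpen_interior.mem_nhds (by simpa using ha))
  have h1 : ∀ᶠ ε : ℝ in nhdsWithin 0 (Set.Ioi 0), a + ε • b ∈ interior (K : Set Y) :=
    h0.filter_mono nhdsWithin_le_nhds
  obtain ⟨ε, h, hε⟩ := (h1.and self_mem_nhdsWithin).exists
  exact ⟨ε, hε, h⟩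

/-- Interior points are order units: k + εy stays interior for small ε, and one rescales by 1/ε. -/
lemma exists_pos_smul_add_mem_interior {k : Y} (hk : k ∈ interior (K : Set Y)) (y : Y) :
    ∃ t : ℝ, 0 < t ∧ y + t • k ∈ interior (K : Set Y) := by
  obtain ⟨ε, hε, h⟩ := exists_pos_add_smul_mem_interior hk y
  refine ⟨ε⁻¹, inv_pos.2 hε, ?_⟩
  have := smul_mem_interior_cone (inv_pos.2 hε) h
  rwa [smul_add, smul_smul, inv_mul_cancel₀ hε.ne', one_smul, add_comm] at this

lemma zero_notMem_interior_cone (hK : (K : Set Y) ≠ Set.univ) : (0 : Y) ∉ interior (K : Set Y) := by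
  intro h
  refine hK (Set.eq_univ_of_forall fun y => ?_)
  obtain ⟨ε, hε, h'⟩ := exists_pos_add_smul_mem_interior h y
  have := K.smul_mem (interior_subset h') (inv_pos.2 hε).le
  rwa [zero_add, smul_smul, inv_mul_cancel₀ hε.ne', one_smul] at this

/-- A functional that is nonnegative on a cone and does not vanish identically is positive on the
interior of the cone. -/
lemma pos_of_mem_interior {φ : Y →L[ℝ] ℝ} (hφ : φ ∈ dualCone K) (h0 : φ ≠ 0) {k : Y}
    (hk : k ∈ interior (K : Set Y)) : 0 < φ k := by
  refine (hφ k (interior_subset hk)).lt_of_ne fun h => h0 ?_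
  have key : ∀ y, 0 ≤ φ y := fun y => by
    obtain ⟨ε, hε, h'⟩ := exists_pos_add_smul_mem_interior hk y
    have := hφ _ (interior_subset h')
    rw [map_add, map_smul, ← h, zero_add, smul_eq_mul] at this
    exact nonneg_of_mul_nonneg_right this hε
  ext y
  have := key (-y)
  rw [map_neg] at this
  exact le_antisymm (by simpa using this) (key y)

end Cone

/-! ### Weak suprema and infima; an abstract strong duality criterion -/

section Order

variable {Y : Type*} [AddCommGroup Y] [Module ℝ Y] [TopologicalSpace Y] [IsTopologicalAddGroup Y]
  [ContinuousSMul ℝ Y] {K : ProperCone ℝ Y}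

lemma Ext.neg_neg (a : Ext Y) : - -a = a := by
  cases a with
  | negInf => rfl
  | fin y => exact congrArg Ext.fin (_root_.neg_neg y)
  | posInf => rfl

lemma wlt_fin_iff {a b : Y} : wlt K (a : Ext Y) (b : Ext Y) ↔ b - a ∈ interior (K : Set Y) := by
  simp [wlt]

lemma wlt_neg_iff {a b : Ext Y} : wlt K (-a) (-b) ↔ wlt K b a := by
  cases a <;> cases b <;> try exact Iff.rfl
  rename_i a b
  change wlt K ((-a : Y) : Ext Y) ((-b : Y) : Ext Y) ↔ _
  rw [wlt_fin_iff, wlt_fin_iff, neg_sub_neg]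

lemma wlt_of_wlt_of_sub_mem {a : Ext Y} {y w : Y} (h : wlt K a y) (hw : w - y ∈ K) :
    wlt K a w := by
  cases a with
  | negInf => trivial
  | fin a =>
    rw [wlt_fin_iff] at h ⊢
    simpa using add_mem_interior_cone hw h
  | posInf => exact h.elim

lemma mem_winf_iff_neg_mem_wsup {M : Set (Ext Y)} {v : Ext Y} :
    v ∈ winf K M ↔ -v ∈ wsup K ((fun a => -a) '' M) := by
  constructor
  · rintro ⟨h1, h2⟩
    refine ⟨?_, fun v' hv' => ?_⟩
    · rintro _ ⟨w, hw, rfl⟩ h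
      exact h1 w hw (wlt_neg_iff.1 h)
    · obtain ⟨w, hw, h⟩ := h2 (-v') (by rwa [← wlt_neg_iff, Ext.neg_neg])
      exact ⟨-w, ⟨w, hw, rfl⟩, by rwa [← wlt_neg_iff, Ext.neg_neg] at h⟩
  · rintro ⟨h1, h2⟩
    refine ⟨fun w hw h => h1 (-w) ⟨w, hw, rfl⟩ (wlt_neg_iff.2 h), fun v' hv' => ?_⟩
    obtain ⟨_, ⟨w, hw, rfl⟩, h⟩ := h2 (-v') (wlt_neg_iff.2 hv')
    exact ⟨w, hw, wlt_neg_iff.1 h⟩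

/-- The point where a line in an interior direction of the cone leaves the lower set generated by
`M` is a weak supremum of `M`. -/
lemma sub_sInf_smul_mem_wsup {k : Y} (hk : k ∈ interior (K : Set Y)) {M : Set (Ext Y)}
    (hM : Ext.posInf ∉ M) {y : Y}
    (hne : {t : ℝ | ∃ p : Y, (p : Ext Y) ∈ M ∧ p - y + t • k ∈ interior (K : Set Y)}.Nonempty)
    (hb : BddBelow {t : ℝ | ∃ p : Y, (p : Ext Y) ∈ M ∧ p - y + t • k ∈ interior (K : Set Y)}) :
    ((y - sInf {t : ℝ | ∃ p : Y, (p : Ext Y) ∈ M ∧ p - y + t • k ∈ interior (K : Set Y)} • k : Y) :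
      Ext Y) ∈ wsup K M := by
  set R := {t : ℝ | ∃ p : Y, (p : Ext Y) ∈ M ∧ p - y + t • k ∈ interior (K : Set Y)}
  -- The infimum is not attained because int K is open: a member of R can always be decreased a
  -- little.
  have hs : sInf R ∉ R := by
    rintro ⟨p, hp, h⟩
    obtain ⟨ε, hε, h'⟩ := exists_pos_add_smul_mem_interior h (-k)
    have : sInf R - ε ∈ R := ⟨p, hp, by convert h' using 1; module⟩
    linarith [csInf_le hb this]
  have hgt : ∀ t, sInf R < t → t ∈ R := by
    intro t ht
    obtain ⟨r, ⟨p, hp, h⟩, hr⟩ := exists_lt_of_csInf_lt hne ht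
    refine ⟨p, hp, ?_⟩
    have := add_mem_interior_cone (K.smul_mem (interior_subset hk) (sub_pos.2 hr).le) h
    convert this using 1
    module
  constructor
  · rintro (_ | p | _) hv h
    · exact h
    · rw [wlt_fin_iff] at h
      exact hs ⟨p, hv, by convert h using 1; module⟩
    · exact hM hv
  · rintro (_ | a | _) h
    · obtain ⟨_, p, hp, -⟩ := hne
      exact ⟨p, hp, trivial⟩
    · rw [wlt_fin_iff] at h
      obtain ⟨ε, hε, h'⟩ := exists_pos_add_smul_mem_interior h (-k)
      obtain ⟨p, hp, h''⟩ := hgt (sInf R + ε) (by linarith)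
      refine ⟨p, hp, wlt_fin_iff.2 ?_⟩
      have := add_mem_interior_cone (interior_subset h') h''
      convert this using 1
      module
    · exact h.elim

/-- Every finite weak upper bound of `M` dominates a weak supremum of `M`. -/
lemma exists_mem_wsup_le (hKint : (interior (K : Set Y)).Nonempty) {M : Set (Ext Y)} {m y : Y}
    (hm : (m : Ext Y) ∈ M) (hy : ∀ v ∈ M, ¬ wlt K y v) :
    ∃ w : Y, (w : Ext Y) ∈ wsup K M ∧ y - w ∈ K := by
  obtain ⟨k, hk⟩ := hKint
  have hpos : ∀ t ∈ {t : ℝ | ∃ p : Y, (p : Ext Y) ∈ M ∧ p - y + t • k ∈ interior (K : Set Y)},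
      0 ≤ t := by
    -- A negative t would put p strictly above y, since -t k lies in K.
    rintro t ⟨p, hp, h⟩
    by_contra! ht
    refine hy _ hp (wlt_fin_iff.2 ?_)
    have := add_mem_interior_cone (K.smul_mem (interior_subset hk) (neg_pos.2 ht).le) h
    convert this using 1
    module
  obtain ⟨t, -, ht⟩ := exists_pos_smul_add_mem_interior hk (m - y)
  refine ⟨_, sub_sInf_smul_mem_wsup hk (fun h => hy _ h trivial) ⟨t, m, hm, ht⟩ ⟨0, hpos⟩, ?_⟩
  rw [sub_sub_cancel]
  exact K.smul_mem (interior_subset hk) (Real.sInf_nonneg hpos)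

/-- Every finite weak lower bound of `M` is dominated by a weak infimum of `M`. -/
lemma exists_mem_winf_ge (hKint : (interior (K : Set Y)).Nonempty) {M : Set (Ext Y)} {m y : Y}
    (hm : (m : Ext Y) ∈ M) (hy : ∀ v ∈ M, ¬ wlt K v y) :
    ∃ w : Y, (w : Ext Y) ∈ winf K M ∧ w - y ∈ K := by
  obtain ⟨w, hw, h⟩ := exists_mem_wsup_le hKint (M := (fun a => -a) '' M) (m := -m) (y := -y)
    ⟨m, hm, rfl⟩ (by
      rintro _ ⟨v, hv, rfl⟩ h
      exact hy v hv (wlt_neg_iff.1 h))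
  refine ⟨-w, mem_winf_iff_neg_mem_wsup.2 ?_, by rwa [show -w - y = -y - w by abel]⟩
  change ((- -w : Y) : Ext Y) ∈ _
  rwa [_root_.neg_neg]

/-- Strong duality between a minimization problem with value set `P` and a dual family `Q` for
which weak duality holds: it means that each finite weak lower bound of `P` is a weak lower bound
of one of the sets `Q i`. -/
theorem wmax_eq_winf_iff (hKint : (interior (K : Set Y)).Nonempty) {ι : Type*} [Nonempty ι]
    {P D : Set (Ext Y)} {Q : ι → Set (Ext Y)} (hD : ∀ v, v ∈ D ↔ ∃ i, v ∈ winf K (Q i))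
    {p : Y} (hp : (p : Ext Y) ∈ P)
    (hweak : ∀ i, ∀ q ∈ P, ∀ v, wlt K q v → ∃ q' ∈ Q i, wlt K q' v) :
    wmax K D = winf K P ↔
      ∀ y : Y, (∀ q ∈ P, ¬ wlt K q y) → ∃ i, ∀ q ∈ Q i, ¬ wlt K q y := by
  have hDP : ∀ d ∈ D, ∀ q ∈ P, ¬ wlt K q d := by
    intro d hd q hq h
    obtain ⟨i, hi⟩ := (hD d).1 hd
    obtain ⟨q', hq', h'⟩ := hweak i q hq d h
    exact hi.1 q' hq' h'
  constructor
  · intro h y hy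
    obtain ⟨w, hw, hwy⟩ := exists_mem_winf_ge hKint hp hy
    rw [← h] at hw
    obtain ⟨i, hi⟩ := (hD _).1 hw.1
    exact ⟨i, fun q hq hqy => hi.1 q hq (wlt_of_wlt_of_sub_mem hqy hwy)⟩
  · intro h
    -- If P has no finite weak lower bound, weak duality forces both sides to be {-∞}; otherwise all
    -- weak infima of P are finite and the hypothesis places them in D.
    by_cases hlb : ∃ y : Y, ∀ q ∈ P, ¬ wlt K q y
    · obtain ⟨y, hy⟩ := hlb
      have hsub : winf K P ⊆ D := by
        intro v hv
        rcases v with _ | v | _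
        · obtain ⟨q, hq, hqy⟩ := hv.2 y trivial
          exact (hy q hq hqy).elim
        · obtain ⟨i, hi⟩ := h v hv.1
          refine (hD _).2 ⟨i, hi, fun v' hv' => ?_⟩
          obtain ⟨q, hq, hqv⟩ := hv.2 v' hv'
          exact hweak i q hq v' hqv
        · exact (hv.1 p hp trivial).elim
      refine Set.Subset.antisymm ?_ fun v hv => ⟨hsub hv, ?_, fun v' hv' => ⟨v, hsub hv, hv'⟩⟩
      · rintro v ⟨hv, hmax⟩
        refine ⟨hDP v hv, fun v' hv' => ?_⟩
        -- Otherwise v' is a weak lower bound of P, so some weak infimum w of P dominates it; w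
        -- belongs to D and lies strictly above v, contradicting maximality.
        by_contra! hcon
        rcases v' with _ | v' | _
        · rcases v with _ | v | _ <;> exact hv'.elim
        · obtain ⟨w, hw, hwy⟩ := exists_mem_winf_ge hKint hp hcon
          exact hmax.1 w (hsub hw) (wlt_of_wlt_of_sub_mem hv' hwy)
        · exact hcon p hp trivial
      · intro d hd hvd
        obtain ⟨q, hq, hqd⟩ := hv.2 d hvd
        exact hDP d hd q hq hqd
    · push Not at hlb
      have hDsub : ∀ d ∈ D, d = .negInf := by
        rintro (_ | d | _) hd
        · rfl
        · obtain ⟨q, hq, hqd⟩ := hlb d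
          exact (hDP _ hd q hq hqd).elim
        · exact (hDP _ hd p hp trivial).elim
      have hbot : ∀ q : Ext Y, ¬ wlt K q .negInf := by
        rintro (_ | q | _) hq <;> exact hq.elim
      have hlbP : ∀ v', wlt K .negInf v' → ∃ q ∈ P, wlt K q v' := by
        rintro (_ | v' | _) hv'
        · exact hv'.elim
        · exact hlb v'
        · exact ⟨p, hp, trivial⟩
      have hmem : Ext.negInf ∈ D := by
        obtain ⟨i⟩ := ‹Nonempty ι›
        refine (hD _).2 ⟨i, fun q _ => hbot q, fun v' hv' => ?_⟩
        obtain ⟨q, hq, hqv⟩ := hlbP v' hv'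
        exact hweak i q hq v' hqv
      have hP : ∀ v, v ∈ winf K P ↔ v = .negInf := by
        intro v
        constructor
        · rcases v with _ | v | _
          · exact fun _ => rfl
          · intro hv
            obtain ⟨q, hq, hqv⟩ := hlb v
            exact (hv.1 q hq hqv).elim
          · exact fun hv => (hv.1 p hp trivial).elim
        · rintro rfl
          exact ⟨fun q _ => hbot q, hlbP⟩
      ext v
      rw [hP]
      constructor
      · exact fun hv => hDsub v hv.1
      · rintro rfl
        refine ⟨hmem, fun d hd => ?_, fun v' hv' => (hbot _ hv').elim⟩
        rw [hDsub d hd]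
        exact hbot _

end Order

end

end RobustVector

namespace RobustVector

noncomputable section

/-! ### Epigraphs and conjugates in terms of finite values -/

section Conjugate

variable {X Y : Type*} [AddCommGroup X] [Module ℝ X] [TopologicalSpace X]
  [AddCommGroup Y] [Module ℝ Y] [TopologicalSpace Y] [IsTopologicalAddGroup Y]
  [ContinuousSMul ℝ Y] {K : ProperCone ℝ Y}

lemma Ext.fin_injective {Y : Type*} : Function.Injective (Ext.fin : Y → Ext Y) :=
  fun _ _ h => by cases h; rfl

lemma Ext.fin_add_fin (a b : Y) : (a : Ext Y) + (b : Ext Y) = ((a + b : Y) : Ext Y) := rfl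

lemma Ext.fin_sub_fin (a b : Y) : (a : Ext Y) - (b : Ext Y) = ((a - b : Y) : Ext Y) := by
  rw [sub_eq_add_neg]
  rfl

lemma Ext.posInf_add (a : Ext Y) : Ext.posInf + a = .posInf := by
  rcases a with _ | a | _ <;> rfl

lemma Ext.add_posInf (a : Ext Y) : a + Ext.posInf = .posInf := by
  rcases a with _ | a | _ <;> rfl

lemma Ext.negInf_add_fin (a : Y) : Ext.negInf + (a : Ext Y) = .negInf := rfl

lemma Ext.fin_add_negInf (a : Y) : (a : Ext Y) + Ext.negInf = .negInf := rfl

lemma Ext.negInf_add_negInf : (Ext.negInf + Ext.negInf : Ext Y) = .negInf := rfl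

lemma Ext.add_fin_eq_fin_iff {a : Ext Y} {b c : Y} :
    a + (b : Ext Y) = (c : Ext Y) ↔ a = ((c - b : Y) : Ext Y) := by
  rcases a with _ | a | _
  · exact ⟨fun h => Ext.noConfusion rfl (heq_of_eq h), fun h => Ext.noConfusion rfl (heq_of_eq h)⟩
  · rw [Ext.fin_add_fin, Ext.fin_injective.eq_iff, Ext.fin_injective.eq_iff, eq_sub_iff_add_eq]
  · exact ⟨fun h => Ext.noConfusion rfl (heq_of_eq h), fun h => Ext.noConfusion rfl (heq_of_eq h)⟩

lemma mem_epi_iff {H : X → Ext Y} {x : X} {y : Y} :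
    (x, y) ∈ epi K H ↔ ∃ h : Y, H x = h ∧ y - h ∈ K := by
  constructor
  · rintro ⟨k, hk, h⟩
    exact ⟨y - k, Ext.add_fin_eq_fin_iff.1 h.symm, by simpa using hk⟩
  · rintro ⟨h, hH, hk⟩
    refine ⟨y - h, hk, (Ext.add_fin_eq_fin_iff.2 ?_).symm⟩
    simpa using hH

/-- Each finite weak upper bound dominates a weak supremum, so the epigraph of the conjugate
consists of all such bounds. From here on weak suprema can be replaced by plain exclusions from int
K. -/
lemma mem_epiConj_iff (hKint : (interior (K : Set Y)).Nonempty) {H : X → Ext Y}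
    (hH : ∀ x, H x ≠ .negInf) (hne : ∃ x, ∃ h : Y, H x = h) {L : X →Lₚₜ[ℝ] Y} {y : Y} :
    (L, y) ∈ epiConj K H ↔
      ∀ x, ∀ h : Y, H x = h → L x - h - y ∉ interior (K : Set Y) := by
  constructor
  · rintro ⟨w, hw, k, hk, h⟩ x a hx hmem
    obtain rfl := Ext.add_fin_eq_fin_iff.1 h.symm
    refine hw.1 _ ⟨x, rfl⟩ ?_
    simp only [hx, Ext.fin_sub_fin, wlt_fin_iff]
    have := add_mem_interior_cone hk hmem
    convert this using 1
    abel
  · intro h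
    obtain ⟨x₀, h₀, hx₀⟩ := hne
    obtain ⟨w, hw, hwy⟩ := exists_mem_wsup_le hKint (y := y) (m := L x₀ - h₀)
      (M := Set.range fun x => (L x : Ext Y) - H x)
      ⟨x₀, by simp only [hx₀, Ext.fin_sub_fin]⟩ (by
        rintro _ ⟨x, rfl⟩ hlt
        rcases hx : H x with _ | a | _
        · exact hH x hx
        · simp only [hx, Ext.fin_sub_fin, wlt_fin_iff] at hlt
          exact h x a hx hlt
        · simp only [hx] at hlt
          exact hlt)
    exact ⟨w, hw, y - w, hwy, by rw [Ext.fin_add_fin]; congr 1; abel⟩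

end Conjugate

/-! ### Qualifying sets and their relation to duality -/

section Problem

variable {X Y Z U : Type*}
  [AddCommGroup X] [Module ℝ X] [TopologicalSpace X]
  [AddCommGroup Y] [Module ℝ Y] [TopologicalSpace Y] [IsTopologicalAddGroup Y]
  [ContinuousSMul ℝ Y]
  [AddCommGroup Z] [Module ℝ Z] [TopologicalSpace Z]
  {K : ProperCone ℝ Y} {S : ProperCone ℝ Z} {C : Set X} {F : X → Ext Y} {G : U → X → Ext Z}

lemma lagrangian_eq_fin_iff {g : X → Ext Z} {T : Z →Lₚₜ[ℝ] Y} {x : X} {b : Y} :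
    lagrangian C F g T x = b ↔
      x ∈ C ∧ ∃ (a : Y) (z : Z), F x = (a : Ext Y) ∧ g x = (z : Ext Z) ∧ b = a + T z := by
  by_cases hx : x ∈ C
  · simp only [lagrangian, indicator, hx, if_true, true_and]
    rcases hF : F x with _ | a | _ <;> rcases hg : g x with _ | z | _ <;>
      simp [Ext.map, Ext.fin_add_fin, Ext.posInf_add, Ext.add_posInf, Ext.negInf_add_fin,
        Ext.fin_add_negInf, Ext.negInf_add_negInf, Ext.fin_injective.eq_iff, eq_comm]
  · have : lagrangian C F g T x = .posInf := by
      simp only [lagrangian, indicator, hx, if_false]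
      rcases F x with _ | a | _ <;> rcases g x with _ | z | _ <;> rfl
    simp [this, hx]

lemma lagrangian_ne_negInf {g : X → Ext Z} {T : Z →Lₚₜ[ℝ] Y} {x : X} (hF : F x ≠ .negInf)
    (hg : g x ≠ .negInf) : lagrangian C F g T x ≠ .negInf := by
  by_cases hx : x ∈ C
  · simp only [lagrangian, indicator, hx, if_true]
    rcases hF' : F x with _ | a | _ <;> rcases hg' : g x with _ | z | _ <;>
      first
      | exact (hF hF').elim
      | exact (hg hg').elim
      | exact fun h => (Ext.noConfusion rfl (heq_of_eq h))
  · simp only [lagrangian, indicator, hx, if_false]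
    rcases F x with _ | a | _ <;> rcases g x with _ | z | _ <;>
      exact fun h => (Ext.noConfusion rfl (heq_of_eq h))

/-- The `K`-epigraph of the conjugate of `F + I_A`, where `A` is the feasible set. -/
def feasEpiConj (K : ProperCone ℝ Y) (S : ProperCone ℝ Z) (C : Set X) (F : X → Ext Y)
    (G : U → X → Ext Z) : Set ((X →Lₚₜ[ℝ] Y) × Y) :=
  {p | ∀ x ∈ feasible S C G, ∀ a : Y, F x = a → p.1 x - a - p.2 ∉ interior (K : Set Y)}

/-- Properness of the data, and feasibility of a point of the domain of the objective. -/
structure ProperData (S : ProperCone ℝ Z) (C : Set X) (F : X → Ext Y)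
    (G : U → X → Ext Z) : Prop where
  ne_negInf_F : ∀ x, F x ≠ .negInf
  ne_negInf_G : ∀ u x, G u x ≠ .negInf
  exists_feasible : ∃ x ∈ feasible S C G, ∃ a : Y, F x = a

lemma ProperData.exists_lagrangian_eq (h : ProperData S C F G) (u : U) (T : Z →Lₚₜ[ℝ] Y) :
    ∃ x, ∃ b : Y, lagrangian C F (G u) T x = b := by
  obtain ⟨x, hx, a, ha⟩ := h.exists_feasible
  obtain ⟨s, -, hs⟩ := hx.2 u
  exact ⟨x, _, lagrangian_eq_fin_iff.2 ⟨hx.1, a, -s, ha, hs, rfl⟩⟩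

lemma mem_epiConj_lagrangian_iff (h : ProperData S C F G)
    (hKint : (interior (K : Set Y)).Nonempty) {T : Z →Lₚₜ[ℝ] Y} {u : U} {L : X →Lₚₜ[ℝ] Y} {y : Y} :
    (L, y) ∈ epiConj K (lagrangian C F (G u) T) ↔ ∀ x ∈ C, ∀ (a : Y) (z : Z), F x = a →
      G u x = z → L x - (a + T z) - y ∉ interior (K : Set Y) := by
  rw [mem_epiConj_iff hKint
    (fun x => lagrangian_ne_negInf (h.ne_negInf_F x) (h.ne_negInf_G u x))
    (h.exists_lagrangian_eq u T)]
  constructor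
  · intro H x hx a z ha hz
    exact H x _ (lagrangian_eq_fin_iff.2 ⟨hx, a, z, ha, hz, rfl⟩)
  · intro H x b hb
    obtain ⟨hx, a, z, ha, hz, rfl⟩ := lagrangian_eq_fin_iff.1 hb
    exact H x hx a z ha hz

lemma mem_qualA_iff (h : ProperData S C F G) (hKint : (interior (K : Set Y)).Nonempty)
    {L : X →Lₚₜ[ℝ] Y} {y : Y} :
    (L, y) ∈ qualA K S C F G ↔ ∃ T ∈ posOp S K, ∃ u, ∀ x ∈ C, ∀ (a : Y) (z : Z), F x = a →
      G u x = z → L x - (a + T z) - y ∉ interior (K : Set Y) := by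
  simp only [qualA, Set.mem_iUnion, mem_epiConj_lagrangian_iff h hKint, exists_prop]

/-- Points outside -S contribute the value -∞, which is never strictly above anything. -/
lemma mem_conj_indicator_neg_cone {T : Z →Lₚₜ[ℝ] Y} {v : Ext Y} :
    v ∈ conj K (indicator {z : Z | -z ∈ S}) T ↔
      (∀ s ∈ S, ¬ wlt K v ((-(T s) : Y) : Ext Y)) ∧
        ∀ v', wlt K v' v → ∃ s ∈ S, wlt K v' ((-(T s) : Y) : Ext Y) := by
  have hin : ∀ s ∈ S, (T (-s) : Ext Y) - indicator {z : Z | -z ∈ S} (-s) =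
      ((-(T s) : Y) : Ext Y) := by
    intro s hs
    simp [indicator, hs, Ext.fin_sub_fin]
  have hout : ∀ z : Z, -z ∉ S →
      (T z : Ext Y) - (indicator {z : Z | -z ∈ S} z : Ext Y) = .negInf := by
    intro z hz
    simp only [indicator, Set.mem_ofPred_eq, hz, if_false]
    rfl
  have hbot : ∀ w : Ext Y, ¬ wlt K w .negInf := by
    rintro (_ | w | _) hw <;> exact hw.elim
  constructor
  · rintro ⟨h1, h2⟩
    refine ⟨fun s hs hlt => h1 _ ⟨-s, rfl⟩ (by simpa only [hin s hs] using hlt), fun v' hv' => ?_⟩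
    obtain ⟨_, ⟨z, rfl⟩, hlt⟩ := h2 v' hv'
    by_cases hz : -z ∈ S
    · exact ⟨-z, hz, by rw [← hin _ hz]; simpa using hlt⟩
    · simp only [hout z hz] at hlt
      exact (hbot _ hlt).elim
  · rintro ⟨h1, h2⟩
    refine ⟨?_, fun v' hv' => ?_⟩
    · rintro _ ⟨z, rfl⟩ hlt
      by_cases hz : -z ∈ S
      · refine h1 _ hz ?_
        rw [← hin _ hz]
        simpa using hlt
      · simp only [hout z hz] at hlt
        exact hbot _ hlt
    · obtain ⟨s, hs, hlt⟩ := h2 v' hv'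
      exact ⟨_, ⟨-s, rfl⟩, by simpa only [hin s hs] using hlt⟩

/-- For a weakly positive operator `T`, every element of `T(-S)` lies below a weak supremum of
`T(-S)`. -/
lemma exists_mem_conj_indicator_ge (hKint : (interior (K : Set Y)).Nonempty) {T : Z →Lₚₜ[ℝ] Y}
    (hT : T ∈ weakPosOp S K) {s : Z} (hs : s ∈ S) :
    ∃ v : Y, (v : Ext Y) ∈ conj K (indicator {z : Z | -z ∈ S}) T ∧ v + T s ∈ K := by
  obtain ⟨k, hk⟩ := hKint
  set M : Set (Ext Y) := (fun s => ((-(T s) : Y) : Ext Y)) '' (S : Set Z)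
  set R := {t : ℝ | ∃ p : Y, (p : Ext Y) ∈ M ∧ p - -(T s) + t • k ∈ interior (K : Set Y)}
  have hM : Ext.posInf ∉ M := by
    rintro ⟨_, _, h⟩
    exact (Ext.noConfusion rfl (heq_of_eq h))
  have hpos : ∀ t : ℝ, 0 < t → t ∈ R := fun t ht =>
    ⟨-(T s), ⟨s, hs, rfl⟩, by simpa using smul_mem_interior_cone ht hk⟩
  obtain ⟨t₀, ht₀, hmem⟩ := exists_pos_smul_add_mem_interior hk (-(T s))
  -- Weak positivity enters here: t < -t₀ would force -T(s') into int K.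
  have hbdd : BddBelow R := by
    refine ⟨-t₀, ?_⟩
    rintro t ⟨_, ⟨s', hs', heq⟩, hp⟩
    obtain rfl := Ext.fin_injective heq
    by_contra! hlt
    refine hT s' hs' ?_
    have h1 := add_mem_interior_cone (interior_subset hmem) hp
    have h2 := add_mem_interior_cone
      (K.smul_mem (interior_subset hk) (show 0 ≤ -t₀ - t by linarith)) h1
    convert h2 using 1
    module
  have hsup := sub_sInf_smul_mem_wsup hk hM ⟨1, hpos 1 one_pos⟩ hbdd
  refine ⟨_, mem_conj_indicator_neg_cone.2 ⟨fun s hs => hsup.1 _ ⟨s, hs, rfl⟩, fun v' hv' => ?_⟩, ?_⟩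
  · obtain ⟨_, ⟨s, hs, rfl⟩, h⟩ := hsup.2 v' hv'
    exact ⟨s, hs, h⟩
  · have hle : sInf R ≤ 0 := le_of_forall_gt_imp_ge_of_dense fun t ht => csInf_le hbdd (hpos t ht)
    have := K.smul_mem (interior_subset hk) (neg_nonneg.2 hle)
    convert this using 1
    change -(T s) - sInf R • k + T s = _
    module

/-- The intersection over v in I*_{-S}(T) is traded for a quantifier over s in S: each -T(s) lies
below some v, and whatever is strictly below v is strictly below some -T(s). -/
lemma mem_qualB_iff (h : ProperData S C F G) (hKint : (interior (K : Set Y)).Nonempty)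
    {L : X →Lₚₜ[ℝ] Y} {y : Y} :
    (L, y) ∈ qualB K S C F G ↔ ∃ T ∈ weakPosOp S K, ∃ u, ∀ x ∈ C, ∀ s ∈ S, ∀ (a : Y) (z : Z),
      F x = a → G u x = z → L x - (a + T z + T s) - y ∉ interior (K : Set Y) := by
  simp only [qualB, Set.mem_iUnion, Set.mem_iInter, exists_prop]
  refine exists_congr fun T => and_congr_right fun hT => exists_congr fun u => ?_
  have himg : ∀ v : Y, (L, y) ∈ (fun p : (X →Lₚₜ[ℝ] Y) × Y => p + (0, v)) ''
      epiConj K (lagrangian C F (G u) T) ↔ ∀ x ∈ C, ∀ (a : Y) (z : Z), F x = a →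
        G u x = z → L x - (a + T z) - (y - v) ∉ interior (K : Set Y) := by
    intro v
    rw [← mem_epiConj_lagrangian_iff h hKint]
    constructor
    · rintro ⟨⟨L', y'⟩, hp, heq⟩
      simp only [Prod.mk_add_mk, add_zero, Prod.mk.injEq] at heq
      obtain ⟨rfl, rfl⟩ := heq
      simpa using hp
    · intro hp
      exact ⟨_, hp, by simp⟩
  simp only [himg, Set.mem_ofPred_eq]
  constructor
  · intro H x hx s hs a z ha hz hmem
    obtain ⟨v, hv, hvs⟩ := exists_mem_conj_indicator_ge hKint hT hs
    refine H v hv x hx a z ha hz ?_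
    convert add_mem_interior_cone hvs hmem using 1
    abel
  · intro H v hv x hx a z ha hz hmem
    obtain ⟨s, hs, hlt⟩ := (mem_conj_indicator_neg_cone.1 hv).2 ((a + T z - L x + y : Y) : Ext Y)
      (wlt_fin_iff.2 (by convert hmem using 1; abel))
    refine H x hx s hs a z ha hz ?_
    rw [wlt_fin_iff] at hlt
    convert hlt using 1
    abel

lemma qualA_subset_qualB (h : ProperData S C F G) (hK : (K : Set Y) ≠ Set.univ)
    (hKint : (interior (K : Set Y)).Nonempty) : qualA K S C F G ⊆ qualB K S C F G := by
  rintro ⟨L, y⟩ hp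
  obtain ⟨T, hT, u, H⟩ := (mem_qualA_iff h hKint).1 hp
  refine (mem_qualB_iff h hKint).2 ⟨T, fun s hs hmem => ?_, u, ?_⟩
  · have := add_mem_interior_cone (hT s hs) hmem
    rw [add_neg_cancel] at this
    exact zero_notMem_interior_cone hK this
  · intro x hx s hs a z ha hz hmem
    refine H x hx a z ha hz ?_
    convert add_mem_interior_cone (hT s hs) hmem using 1
    abel

lemma qualB_subset_feasEpiConj (h : ProperData S C F G)
    (hKint : (interior (K : Set Y)).Nonempty) : qualB K S C F G ⊆ feasEpiConj K S C F G := by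
  rintro ⟨L, y⟩ hp x hx a ha hmem
  obtain ⟨T, hT, u, H⟩ := (mem_qualB_iff h hKint).1 hp
  obtain ⟨s, hs, hG⟩ := hx.2 u
  -- Taking the slack s = -G_u(x) makes the terms T(G_u(x)) and T(s) cancel, so no positivity of T
  -- is needed.
  refine H x hx.1 s hs a (-s) ha hG ?_
  convert hmem using 2
  rw [map_neg]
  abel

lemma perturb_eq_fin {L : X →Lₚₜ[ℝ] Y} {x : X} {a : Y} (ha : F x = a) :
    perturb F L x = ((a - L x : Y) : Ext Y) := by
  rw [perturb, ha, Ext.fin_sub_fin]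

lemma perturb_eq_posInf {L : X →Lₚₜ[ℝ] Y} {x : X} (ha : F x = .posInf) :
    perturb F L x = .posInf := by
  rw [perturb, ha]
  rfl

lemma not_wlt_posInf_left (v : Ext Y) : ¬ wlt K .posInf v := by
  rcases v with _ | v | _ <;> exact id

/-- The finite weak lower bounds of the perturbed robust problem. -/
lemma forall_not_wlt_primal_iff (h : ProperData S C F G) {L : X →Lₚₜ[ℝ] Y} {y : Y} :
    (∀ q ∈ perturb F L '' feasible S C G, ¬ wlt K q ((-y : Y) : Ext Y)) ↔
      (L, y) ∈ feasEpiConj K S C F G := by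
  constructor
  · intro H x hx a ha hmem
    refine H _ ⟨x, hx, rfl⟩ ?_
    rw [perturb_eq_fin ha, wlt_fin_iff]
    convert hmem using 1
    abel
  · rintro H _ ⟨x, hx, rfl⟩ hlt
    rcases ha : F x with _ | a | _
    · exact h.ne_negInf_F x ha
    · refine H x hx a ha ?_
      rw [perturb_eq_fin ha, wlt_fin_iff] at hlt
      convert hlt using 1
      abel
    · rw [perturb_eq_posInf ha] at hlt
      exact not_wlt_posInf_left _ hlt

/-- Strong stable duality means that the Lagrangian qualifying set is as large as possible. -/
theorem strongStableDuality_iff [Nonempty U] (h : ProperData S C F G)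
    (hKint : (interior (K : Set Y)).Nonempty) (V : Set (X →Lₚₜ[ℝ] Y)) :
    StrongStableDuality K S C F G V ↔
      ∀ L ∈ V, ∀ y, (L, y) ∈ feasEpiConj K S C F G → (L, y) ∈ qualA K S C F G := by
  refine forall₂_congr fun L _ => ?_
  obtain ⟨x₀, hx₀, a₀, ha₀⟩ := h.exists_feasible
  have : Nonempty (posOp S K × U) :=
    ⟨⟨⟨0, fun s _ => by simp⟩, Classical.arbitrary U⟩⟩
  rw [wmaxDual, winfPrimal, wmax_eq_winf_iff hKint
    (P := perturb F L '' feasible S C G)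
    (Q := fun i : posOp S K × U =>
      (fun x => perturb F L x + (G i.2 x).map i.1.1) '' C) (p := a₀ - L x₀) ?_
    ⟨x₀, hx₀, perturb_eq_fin ha₀⟩ ?_]
  -- Lower bounds of F - L are the negatives of upper bounds of L - F.
  · rw [← (Equiv.neg Y).forall_congr_right]
    refine forall_congr' fun y => ?_
    rw [Equiv.neg_apply, forall_not_wlt_primal_iff h, mem_qualA_iff h hKint]
    refine imp_congr_right fun _ => ?_
    simp only [Prod.exists, Subtype.exists, exists_prop]
    refine exists_congr fun T => and_congr_right fun hT => exists_congr fun u => ?_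
    rw [Set.forall_mem_image]
    refine forall₂_congr fun x hx => ?_
    constructor
    · intro H a z ha hz hmem
      refine H ?_
      rw [perturb_eq_fin ha, hz]
      refine wlt_fin_iff.2 ?_
      convert hmem using 1
      abel
    · intro H hlt
      rcases ha : F x with _ | a | _
      · exact h.ne_negInf_F x ha
      · rcases hz : G u x with _ | z | _
        · exact h.ne_negInf_G u x hz
        · refine H a z ha hz ?_
          rw [perturb_eq_fin ha, hz] at hlt
          convert wlt_fin_iff.1 hlt using 1
          abel
        · rw [hz] at hlt
          simp only [Ext.map, Ext.add_posInf] at hlt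
          exact not_wlt_posInf_left _ hlt
      · rw [perturb_eq_posInf ha, Ext.posInf_add] at hlt
        exact not_wlt_posInf_left _ hlt
  · simp
  -- Weak duality: at a feasible point the term T(G_u(x)) lies in -K and only lowers the value.
  · rintro ⟨⟨T, hT⟩, u⟩ _ ⟨x, hx, rfl⟩ v hlt
    refine ⟨_, ⟨x, hx.1, rfl⟩, ?_⟩
    obtain ⟨s, hs, hG⟩ := hx.2 u
    rcases ha : F x with _ | a | _
    · exact (h.ne_negInf_F x ha).elim
    · rw [perturb_eq_fin ha] at hlt
      simp only [perturb_eq_fin ha, hG, Ext.map, Ext.fin_add_fin]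
      rcases v with _ | v | _
      · exact hlt.elim
      · rw [wlt_fin_iff] at hlt ⊢
        convert add_mem_interior_cone (hT s hs) hlt using 1
        rw [map_neg]
        abel
      · trivial
    · rw [perturb_eq_posInf ha] at hlt
      exact (not_wlt_posInf_left _ hlt).elim

/-- Weak strong stable duality means that the weak qualifying set is as large as possible. -/
theorem weakStrongStableDuality_iff [Nonempty U] (h : ProperData S C F G)
    (hK : (K : Set Y) ≠ Set.univ)
    (hKint : (interior (K : Set Y)).Nonempty) (V : Set (X →Lₚₜ[ℝ] Y)) :
    WeakStrongStableDuality K S C F G V ↔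
      ∀ L ∈ V, ∀ y, (L, y) ∈ feasEpiConj K S C F G → (L, y) ∈ qualB K S C F G := by
  refine forall₂_congr fun L _ => ?_
  obtain ⟨x₀, hx₀, a₀, ha₀⟩ := h.exists_feasible
  have : Nonempty (weakPosOp S K × U) :=
    ⟨⟨⟨0, fun s _ => by simpa using zero_notMem_interior_cone hK⟩, Classical.arbitrary U⟩⟩
  rw [wmaxWeakDual, winfPrimal, wmax_eq_winf_iff hKint
    (P := perturb F L '' feasible S C G)
    (Q := fun i : weakPosOp S K × U =>
      (fun p : X × Z => perturb F L p.1 + (G i.2 p.1).map i.1.1 + ((i.1.1 p.2 : Y) : Ext Y)) ''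
        (C ×ˢ (S : Set Z))) (p := a₀ - L x₀) ?_
    ⟨x₀, hx₀, perturb_eq_fin ha₀⟩ ?_]
  · rw [← (Equiv.neg Y).forall_congr_right]
    refine forall_congr' fun y => ?_
    rw [Equiv.neg_apply, forall_not_wlt_primal_iff h, mem_qualB_iff h hKint]
    refine imp_congr_right fun _ => ?_
    simp only [Prod.exists, Subtype.exists, exists_prop]
    refine exists_congr fun T => and_congr_right fun hT => exists_congr fun u => ?_
    rw [Set.forall_mem_image]
    constructor
    · intro H x hx s hs a z ha hz hmem
      refine H (Set.mk_mem_prod hx hs) ?_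
      rw [perturb_eq_fin ha, hz]
      refine wlt_fin_iff.2 ?_
      convert hmem using 1
      change _ - (a - L x + T z + T s) = _
      abel
    · rintro H ⟨x, s⟩ ⟨hx, hs⟩ hlt
      dsimp only at hx hs hlt
      rcases ha : F x with _ | a | _
      · exact h.ne_negInf_F x ha
      · rcases hz : G u x with _ | z | _
        · exact h.ne_negInf_G u x hz
        · refine H x hx s hs a z ha hz ?_
          rw [perturb_eq_fin ha, hz] at hlt
          convert wlt_fin_iff.1 hlt using 1
          abel
        · rw [hz] at hlt
          simp only [Ext.map, Ext.add_posInf, Ext.posInf_add] at hlt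
          exact not_wlt_posInf_left _ hlt
      · rw [perturb_eq_posInf ha, Ext.posInf_add, Ext.posInf_add] at hlt
        exact not_wlt_posInf_left _ hlt
  · simp
  · rintro ⟨⟨T, hT⟩, u⟩ _ ⟨x, hx, rfl⟩ v hlt
    obtain ⟨s, hs, hG⟩ := hx.2 u
    refine ⟨_, ⟨(x, s), ⟨hx.1, hs⟩, rfl⟩, ?_⟩
    rcases ha : F x with _ | a | _
    · exact (h.ne_negInf_F x ha).elim
    · rw [perturb_eq_fin ha] at hlt
      simp only [perturb_eq_fin ha, hG, Ext.map, Ext.fin_add_fin]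
      convert hlt using 2
      rw [map_neg]
      abel
    · rw [perturb_eq_posInf ha] at hlt
      exact (not_wlt_posInf_left _ hlt).elim

end Problem

end

end RobustVector

namespace RobustVector

noncomputable section

/-! ### Scalar robust duality by separation -/

section ScalarDuality

variable {E : Type*} [AddCommGroup E] [Module ℝ E] [TopologicalSpace E] [IsTopologicalAddGroup E]
  [ContinuousSMul ℝ E] [LocallyConvexSpace ℝ E]

/-- A point outside a closed convex epigraph can be strictly separated from it by a hyperplane
whose normal has a nonpositive last coordinate. -/
lemma exists_separation_of_notMem_epigraph {Q : Set (E × ℝ)} (hc : Convex ℝ Q) (hcl : IsClosed Q)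
    (hup : ∀ e t t', (e, t) ∈ Q → t ≤ t' → (e, t') ∈ Q) {e₀ : E} {t₀ : ℝ} (h₀ : (e₀, t₀) ∈ Q)
    {e₁ : E} {μ : ℝ} (h₁ : (e₁, μ) ∉ Q) :
    ∃ (ψ : E →L[ℝ] ℝ) (τ γ : ℝ), 0 ≤ τ ∧ (∀ e t, (e, t) ∈ Q → ψ e - τ * t ≤ γ) ∧
      γ < ψ e₁ - τ * μ := by
  obtain ⟨f, γ, hf, hγ⟩ := geometric_hahn_banach_closed_point hc hcl h₁
  have hdec : ∀ e t, f (e, t) = f (e, 0) + t * f (0, 1) := fun e t => by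
    rw [← smul_eq_mul, ← map_smul, ← map_add]
    simp
  refine ⟨f.comp (ContinuousLinearMap.inl ℝ E ℝ), -f (0, 1), γ, ?_, fun e t h => ?_, ?_⟩
  -- With a positive last coefficient, moving up from (e₀, t₀) inside Q would exceed the bound γ; n
  -- is the height needed.
  · by_contra! hneg
    have hpos : 0 < f (0, 1) := by linarith
    set n := |γ - f (e₀, t₀)| / f (0, 1)
    have h := hf _ (hup e₀ t₀ (t₀ + n) h₀ (by simp only [le_add_iff_nonneg_right]; positivity))
    have hn : n * f (0, 1) = |γ - f (e₀, t₀)| := div_mul_cancel₀ _ hpos.ne'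
    rw [hdec, add_mul, hn, ← add_assoc, ← hdec] at h
    linarith [le_abs_self (γ - f (e₀, t₀))]
  · have := hf _ h
    rw [hdec] at this
    simp only [ContinuousLinearMap.comp_apply, ContinuousLinearMap.inl_apply]
    linarith
  · rw [hdec] at hγ
    simp only [ContinuousLinearMap.comp_apply, ContinuousLinearMap.inl_apply]
    linarith

/-- The Fenchel–Moreau theorem, in terms of epigraphs: a point outside the epigraph of a proper
convex lower semicontinuous function lies below the graph of some continuous affine minorant. -/
lemma exists_affine_minorant {Q : Set (E × ℝ)} (hc : Convex ℝ Q) (hcl : IsClosed Q)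
    (hup : ∀ e t t', (e, t) ∈ Q → t ≤ t' → (e, t') ∈ Q) {e₀ : E} {t₀ s₀ : ℝ} (h₀ : (e₀, t₀) ∈ Q)
    (hs₀ : (e₀, s₀) ∉ Q) {e₁ : E} {μ : ℝ} (h₁ : (e₁, μ) ∉ Q) :
    ∃ (ψ : E →L[ℝ] ℝ) (r : ℝ), (∀ e t, (e, t) ∈ Q → ψ e - t ≤ r) ∧ r < ψ e₁ - μ := by
  have hscale : ∀ (ψ : E →L[ℝ] ℝ) (τ γ : ℝ), 0 < τ → (∀ e t, (e, t) ∈ Q → ψ e - τ * t ≤ γ) →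
      ∀ e t, (e, t) ∈ Q → (τ⁻¹ • ψ) e - t ≤ τ⁻¹ * γ := by
    intro ψ τ γ hτ h e t het
    have := mul_le_mul_of_nonneg_left (h e t het) (inv_pos.2 hτ).le
    rwa [mul_sub, inv_mul_cancel_left₀ hτ.ne'] at this
  -- Separating a point directly below (e₀, t₀) gives a non-vertical hyperplane, since τ = 0 would
  -- mean γ < ψ e₀ ≤ γ.
  obtain ⟨ψ₀, r₀, hψ₀⟩ : ∃ (ψ : E →L[ℝ] ℝ) (r : ℝ), ∀ e t, (e, t) ∈ Q → ψ e - t ≤ r := by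
    obtain ⟨ψ, τ, γ, hτ, h, hγ⟩ := exists_separation_of_notMem_epigraph hc hcl hup h₀ hs₀
    have hτ' : 0 < τ := hτ.lt_of_ne <| by
      rintro rfl
      have := h _ _ h₀
      linarith
    exact ⟨_, _, hscale ψ τ γ hτ' h⟩
  -- This hyperplane may be vertical. Adding ε times the minorant ψ₀ tilts it, and εc < d preserves
  -- the separation gap d.
  obtain ⟨ψ, τ, γ, hτ, h, hγ⟩ := exists_separation_of_notMem_epigraph hc hcl hup h₀ h₁
  set d := ψ e₁ - τ * μ - γ with hd
  set c := r₀ - (ψ₀ e₁ - μ) with hcdef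
  have hdpos : 0 < d := by linarith
  set ε := d / (|c| + 1) with hε
  have hεpos : 0 < ε := by positivity
  have hεc : ε * c < d := by
    have h1 : ε * (|c| + 1) = d := div_mul_cancel₀ _ (by positivity)
    nlinarith [le_abs_self c]
  refine ⟨_, _, hscale (ψ + ε • ψ₀) (τ + ε) (γ + ε * r₀) (by linarith) fun e t het => ?_, ?_⟩
  · have h1 := h e t het
    have h2 := mul_le_mul_of_nonneg_left (hψ₀ e t het) hεpos.le
    simp only [_root_.add_apply, _root_.smul_apply, smul_eq_mul]
    linarith
  · have hpos : 0 < τ + ε := by linarith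
    have h1 : γ + ε * r₀ < (ψ + ε • ψ₀) e₁ - (τ + ε) * μ := by
      simp only [_root_.add_apply, _root_.smul_apply, smul_eq_mul]
      rw [hcdef, hd] at hεc
      linarith
    have h2 := mul_lt_mul_of_pos_left h1 (inv_pos.2 hpos)
    rwa [mul_sub, inv_mul_cancel_left₀ hpos.ne'] at h2

variable {X Z : Type*} [AddCommGroup X] [Module ℝ X] [TopologicalSpace X] [IsTopologicalAddGroup X]
  [ContinuousSMul ℝ X] [LocallyConvexSpace ℝ X]
  [AddCommGroup Z] [Module ℝ Z] [TopologicalSpace Z] [IsTopologicalAddGroup Z]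
  [ContinuousSMul ℝ Z] [LocallyConvexSpace ℝ Z]

/-- Continuous functionals on the dual with the topology of pointwise convergence are
evaluations. -/
lemma exists_eval_eq (f : (X →Lₚₜ[ℝ] ℝ) →L[ℝ] ℝ) : ∃ x : X, ∀ φ : X →Lₚₜ[ℝ] ℝ, f φ = φ x := by
  obtain ⟨x, hx⟩ := LinearMap.dualEmbedding_surjective (topDualPairing ℝ X)
    (f.comp ((PointwiseConvergenceCLM.equivWeakDual ℝ X).symm :
      WeakDual ℝ X →L[ℝ] (X →Lₚₜ[ℝ] ℝ)))
  exact ⟨x, fun φ =>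
    (DFunLike.congr_fun hx (PointwiseConvergenceCLM.equivWeakDual ℝ X φ)).symm⟩

/-- The affine minorants of the infimal projections of the perturbation functions with
epigraphs `Q i` generate, up to weak* closed convex hull, all affine minorants of the supremum of
their traces on `X × {0}`. -/
theorem mem_closure_convexHull_minorants {ι : Type*} [Nonempty ι] {Q : ι → Set ((X × Z) × ℝ)}
    (hc : ∀ i, Convex ℝ (Q i)) (hcl : ∀ i, IsClosed (Q i))
    (hup : ∀ i e t t', (e, t) ∈ Q i → t ≤ t' → (e, t') ∈ Q i) {x₀ : X} {t₀ s₀ : ℝ}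
    (h₀ : ∀ i, ((x₀, 0), t₀) ∈ Q i) (hs₀ : ∀ i, ((x₀, 0), s₀) ∉ Q i)
    {φ : X →Lₚₜ[ℝ] ℝ} {α : ℝ} (hφ : ∀ x t, (∀ i, ((x, 0), t) ∈ Q i) → φ x - t ≤ α) :
    (φ, α) ∈ closure (convexHull ℝ {p : (X →Lₚₜ[ℝ] ℝ) × ℝ |
      ∃ i, ∃ ζ : Z →L[ℝ] ℝ, ∀ x z t, ((x, z), t) ∈ Q i → p.1 x + ζ z - t ≤ p.2}) := by
  set N := {p : (X →Lₚₜ[ℝ] ℝ) × ℝ |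
      ∃ i, ∃ ζ : Z →L[ℝ] ℝ, ∀ x z t, ((x, z), t) ∈ Q i → p.1 x + ζ z - t ≤ p.2}
  have hN : ∀ (i : ι) (ψ : X × Z →L[ℝ] ℝ) (r : ℝ), (∀ e t, (e, t) ∈ Q i → ψ e - t ≤ r) →
      (ContinuousLinearMap.toUniformConvergenceCLM (RingHom.id ℝ) ℝ _
        (ψ.comp (ContinuousLinearMap.inl ℝ X Z)), r) ∈ N := by
    intro i ψ r h
    refine ⟨i, ψ.comp (ContinuousLinearMap.inr ℝ X Z), fun x z t hx => ?_⟩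
    have := h _ _ hx
    simp only [ContinuousLinearMap.toUniformConvergenceCLM_apply, ContinuousLinearMap.comp_apply,
      ContinuousLinearMap.inl_apply, ContinuousLinearMap.inr_apply]
    rwa [← map_add, Prod.mk_add_mk, add_zero, zero_add]
  have : ContinuousSMul ℝ (X →Lₚₜ[ℝ] ℝ) :=
    ⟨PointwiseConvergenceCLM.continuous_of_continuous_eval fun x => continuous_fst.smul
      ((PointwiseConvergenceCLM.evalCLM (RingHom.id ℝ) ℝ x).continuous.comp continuous_snd)⟩
  by_contra hnot
  obtain ⟨f, β, hβ, hf⟩ := geometric_hahn_banach_point_closed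
    (convex_convexHull ℝ N).closure isClosed_closure hnot
  obtain ⟨x₁, hx₁⟩ := exists_eval_eq (f.comp (ContinuousLinearMap.inl ℝ (X →Lₚₜ[ℝ] ℝ) ℝ))
  set l := f (0, 1)
  have hdec : ∀ (ψ : X →Lₚₜ[ℝ] ℝ) (r : ℝ), f (ψ, r) = ψ x₁ + l * r := fun ψ r => by
    rw [← hx₁ ψ, mul_comm, ← smul_eq_mul, ← map_smul]
    simp only [ContinuousLinearMap.comp_apply, ContinuousLinearMap.inl_apply]
    rw [← map_add]
    simp
  have hfN : ∀ ψ r, (ψ, r) ∈ N → β < ψ x₁ + l * r := fun ψ r h => by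
    rw [← hdec]
    exact hf _ (subset_closure (subset_convexHull ℝ N h))
  rw [hdec] at hβ
  -- N is stable under raising the last coordinate, so a negative l would violate the lower bound β.
  have hl : 0 ≤ l := by
    obtain ⟨i⟩ := ‹Nonempty ι›
    obtain ⟨ψ, r, h, -⟩ := exists_affine_minorant (hc i) (hcl i) (hup i) (h₀ i) (hs₀ i) (hs₀ i)
    by_contra! hneg
    have hmem := hN i ψ (r + |ψ (x₁, 0) + l * r - β| / -l)
      fun e t het => (h e t het).trans (by
        have : 0 ≤ |ψ (x₁, 0) + l * r - β| / -l := div_nonneg (abs_nonneg _) (by linarith)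
        linarith)
    have h1 := hfN _ _ hmem
    have h2 : l * (|ψ (x₁, 0) + l * r - β| / -l) = -|ψ (x₁, 0) + l * r - β| := by
      rw [div_neg, mul_neg, mul_div_cancel₀ _ hneg.ne]
    simp only [ContinuousLinearMap.toUniformConvergenceCLM_apply, ContinuousLinearMap.comp_apply,
      ContinuousLinearMap.inl_apply, mul_add, h2] at h1
    linarith [le_abs_self (ψ (x₁, 0) + l * r - β)]
  -- The separating functional is (x₁, l) with l possibly 0. Adding ε times the inequality ψ x₀ - t₀
  -- ≤ r, valid for every minorant, gives a positive coefficient l + ε. Then all minorants are below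
  -- μ at (x₂, 0), so that point lies in every Q i, and `hφ` there yields d ≤ εc, against the choice
  -- of ε.
  set d := β - (φ x₁ + l * α) with hd
  set c := α - φ x₀ + t₀ with hcdef
  have hdpos : 0 < d := by linarith
  have hcnn : 0 ≤ c := by linarith [hφ x₀ t₀ h₀]
  set ε := d / (c + 1) with hε
  have hεpos : 0 < ε := by positivity
  have hεc : ε * c < d := by
    have h1 : ε * (c + 1) = d := div_mul_cancel₀ _ (by positivity)
    linarith
  have hpos : 0 < l + ε := by linarith
  set x₂ := (l + ε)⁻¹ • (ε • x₀ - x₁) with hx₂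
  set μ := (l + ε)⁻¹ * (ε * t₀ - β) with hμ
  have hev : ∀ ψ : X →Lₚₜ[ℝ] ℝ, (l + ε) * ψ x₂ = ε * ψ x₀ - ψ x₁ := fun ψ => by
    rw [hx₂, map_smul, map_sub, map_smul, smul_eq_mul, smul_eq_mul, mul_inv_cancel_left₀ hpos.ne']
  have hμ' : (l + ε) * μ = ε * t₀ - β := by rw [hμ, mul_inv_cancel_left₀ hpos.ne']
  have hmem : ∀ i, ((x₂, 0), μ) ∈ Q i := by
    intro i
    by_contra hni
    obtain ⟨ψ, r, h, hr⟩ := exists_affine_minorant (hc i) (hcl i) (hup i) (h₀ i) (hs₀ i) hni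
    have h1 := hfN _ _ (hN i ψ r h)
    have h2 := mul_le_mul_of_nonneg_left (h _ _ (h₀ i)) hεpos.le
    have h3 := mul_lt_mul_of_pos_left hr hpos
    have h4 := hev (ContinuousLinearMap.toUniformConvergenceCLM (RingHom.id ℝ) ℝ _
        (ψ.comp (ContinuousLinearMap.inl ℝ X Z)))
    simp only [ContinuousLinearMap.toUniformConvergenceCLM_apply, ContinuousLinearMap.comp_apply,
      ContinuousLinearMap.inl_apply] at h1 h4
    linarith
  have h1 := mul_le_mul_of_nonneg_left (hφ x₂ μ hmem) hpos.le
  rw [mul_sub, hev, hμ'] at h1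
  rw [hd, hcdef] at hεc
  linarith

end ScalarDuality

/-! ### Scalarization by functionals of the dual cone -/

section Scalarization

variable {X Y : Type*} [AddCommGroup X] [Module ℝ X] [TopologicalSpace X]
  [AddCommGroup Y] [Module ℝ Y] [TopologicalSpace Y] [IsTopologicalAddGroup Y]
  [ContinuousSMul ℝ Y] {K : ProperCone ℝ Y}

lemma toEReal_le_iff {F : X → Ext Y} {x : X} (hF : F x ≠ .negInf) {φ : Y →L[ℝ] ℝ} {t : ℝ} :
    (F x).toEReal φ ≤ (t : EReal) ↔ ∃ a : Y, F x = a ∧ φ a ≤ t := by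
  rcases h : F x with _ | a | _
  · exact (hF h).elim
  · simp [Ext.toEReal, Ext.fin_injective.eq_iff]
  · simp [Ext.toEReal]

lemma convex_scalarEpigraph {F : X → Ext Y} (hF : IsConvexMap K F) {φ : Y →L[ℝ] ℝ}
    (hφ : φ ∈ dualCone K) : Convex ℝ {p : X × ℝ | ∃ a : Y, F p.1 = a ∧ φ a ≤ p.2} := by
  rintro ⟨x, t⟩ ⟨a, ha, hat⟩ ⟨x', t'⟩ ⟨a', ha', hat'⟩ b b' hb hb' hbb
  have hepi : ∀ {x : X} {a : Y}, F x = a → (x, a) ∈ epi K F := fun {x a} ha =>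
    mem_epi_iff.2 ⟨a, ha, by simp⟩
  have h := hF (hepi ha) (hepi ha') hb hb' hbb
  obtain ⟨c, hc, hk⟩ := mem_epi_iff.1 h
  refine ⟨c, hc, ?_⟩
  have h1 := hφ _ hk
  simp only [Prod.smul_snd, map_sub, map_add, map_smul, smul_eq_mul] at h1
  have h2 := mul_le_mul_of_nonneg_left hat hb
  have h3 := mul_le_mul_of_nonneg_left hat' hb'
  simp only [Prod.snd_add, Prod.smul_snd, smul_eq_mul] at h2 h3 ⊢
  linarith

variable {Z U : Type*} [AddCommGroup Z] [Module ℝ Z] [TopologicalSpace Z]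
  [IsTopologicalAddGroup Z] [ContinuousSMul ℝ Z]
  {S : ProperCone ℝ Z} {C : Set X} {F : X → Ext Y} {G : U → X → Ext Z}

/-- Shows feasibility as the slice z = 0 of the epigraphs of the constraints, where convexity and
closedness are available. -/
lemma mem_feasible_iff {x : X} :
    x ∈ feasible S C G ↔ x ∈ C ∧ ∀ u, (x, (0 : Z)) ∈ epi S (G u) := by
  refine and_congr_right fun _ => forall_congr' fun u => ?_
  rw [mem_epi_iff]
  constructor
  · rintro ⟨s, hs, h⟩
    exact ⟨-s, h, by simpa using hs⟩
  · rintro ⟨z, h, hz⟩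
    exact ⟨-z, by simpa using hz, by simpa using h⟩

lemma convex_feasible (hH : ConvexData K S C F G) : Convex ℝ (feasible S C G) := by
  intro x hx x' hx' b b' hb hb' hbb
  rw [mem_feasible_iff] at hx hx' ⊢
  refine ⟨hH.convex_C hx.1 hx'.1 hb hb' hbb, fun u => ?_⟩
  simpa using hH.convex_G u (hx.2 u) (hx'.2 u) hb hb' hbb

/-- Points of `epi (F + I_A)^*` are scalarized by a functional of the dual cone. -/
lemma exists_scalarization (hP : ProperData S C F G) (hH : ConvexData K S C F G)
    {k : Y} (hk : k ∈ interior (K : Set Y)) {L : X →Lₚₜ[ℝ] Y} {y : Y}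
    (hL : (L, y) ∈ feasEpiConj K S C F G) :
    ∃ φ ∈ dualCone K, φ k = 1 ∧ ∀ x ∈ feasible S C G, ∀ a : Y, F x = a → φ (L x) - φ a ≤ φ y := by
  -- Values are taken from the epigraph of F rather than its graph so that B is convex; B still
  -- misses int K.
  set B : Set Y := {w | ∃ x ∈ feasible S C G, ∃ a, (x, a) ∈ epi K F ∧ w = L x - a - y}
  have hBc : Convex ℝ B := by
    rintro _ ⟨x, hx, a, ha, rfl⟩ _ ⟨x', hx', a', ha', rfl⟩ b b' hb hb' hbb
    refine ⟨_, convex_feasible hH hx hx' hb hb' hbb, b • a + b' • a',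
      hH.convex_F ha ha' hb hb' hbb, ?_⟩
    obtain rfl : b' = 1 - b := by linarith
    simp only [map_add, map_smul]
    module
  have hdisj : Disjoint (interior (K : Set Y)) B := by
    rw [Set.disjoint_left]
    rintro _ hint ⟨x, hx, a, ha, rfl⟩
    obtain ⟨h, hF, hah⟩ := mem_epi_iff.1 ha
    refine hL x hx h hF ?_
    convert add_mem_interior_cone hah hint using 1
    abel
  have hBmem : ∀ x ∈ feasible S C G, ∀ a : Y, F x = a → L x - a - y ∈ B := fun x hx a ha =>
    ⟨x, hx, a, mem_epi_iff.2 ⟨a, ha, by simp⟩, rfl⟩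
  obtain ⟨x₀, hx₀, a₀, ha₀⟩ := hP.exists_feasible
  obtain ⟨f, c, hf, hfK, hfB⟩ := geometric_hahn_banach_of_nonempty_interior K.convex hBc hdisj
    ⟨k, hk⟩ ⟨_, hBmem x₀ hx₀ a₀ ha₀⟩
  have hc : 0 ≤ c := by simpa using hfK 0 K.zero_mem
  have hφ : -f ∈ dualCone K := by
    intro w hw
    rw [_root_.neg_apply, neg_nonneg]
    by_contra! hpos
    have h1 := hfK _ (K.smul_mem hw (show 0 ≤ (c + 1) / f w by positivity))
    rw [map_smul, smul_eq_mul, div_mul_cancel₀ _ hpos.ne'] at h1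
    linarith
  have hkpos := pos_of_mem_interior hφ (neg_ne_zero.2 hf) hk
  refine ⟨((-f) k)⁻¹ • (-f), fun w hw => ?_, inv_mul_cancel₀ hkpos.ne', fun x hx a ha => ?_⟩
  · exact mul_nonneg (inv_pos.2 hkpos).le (hφ w hw)
  · have h1 := hc.trans (hfB _ (hBmem x hx a ha))
    rw [map_sub, map_sub] at h1
    have h2 : (-f) (L x) - (-f) a ≤ (-f) y := by
      simp only [_root_.neg_apply]
      linarith
    have h3 := mul_le_mul_of_nonneg_left h2 (inv_pos.2 hkpos).le
    rwa [mul_sub] at h3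

end Scalarization

/-! ### The closed sectionally convex hull of the qualifying sets -/

section Hull

variable {X Y Z U : Type*}
  [AddCommGroup X] [Module ℝ X] [TopologicalSpace X] [IsTopologicalAddGroup X]
  [ContinuousSMul ℝ X] [LocallyConvexSpace ℝ X]
  [AddCommGroup Y] [Module ℝ Y] [TopologicalSpace Y] [IsTopologicalAddGroup Y]
  [ContinuousSMul ℝ Y]
  [AddCommGroup Z] [Module ℝ Z] [TopologicalSpace Z] [IsTopologicalAddGroup Z]
  [ContinuousSMul ℝ Z] [LocallyConvexSpace ℝ Z]
  {K : ProperCone ℝ Y} {S : ProperCone ℝ Z} {C : Set X} {F : X → Ext Y} {G : U → X → Ext Z}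

lemma kmul_apply (k : Y) (φ : X →L[ℝ] ℝ) (x : X) : kmul k φ x = φ x • k := rfl

/-- The affine embedding of `X* × ℝ` onto the translate `E_k + e`. -/
def sectionMap (k : Y) (e : (X →Lₚₜ[ℝ] Y) × Y) (p : (X →Lₚₜ[ℝ] ℝ) × ℝ) : (X →Lₚₜ[ℝ] Y) × Y :=
  (kmul k ((ContinuousLinearMap.toUniformConvergenceCLM (RingHom.id ℝ) ℝ _).symm p.1), p.2 • k) + e

lemma sectionMap_fst_apply (k : Y) (e : (X →Lₚₜ[ℝ] Y) × Y) (p : (X →Lₚₜ[ℝ] ℝ) × ℝ) (x : X) :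
    (sectionMap k e p).1 x = p.1 x • k + e.1 x := rfl

lemma sectionMap_snd (k : Y) (e : (X →Lₚₜ[ℝ] Y) × Y) (p : (X →Lₚₜ[ℝ] ℝ) × ℝ) :
    (sectionMap k e p).2 = p.2 • k + e.2 := rfl

lemma image_add_kSubspace (k : Y) (e : (X →Lₚₜ[ℝ] Y) × Y) :
    (fun q => q + e) '' kSubspace X k = Set.range (sectionMap k e) := by
  ext q
  constructor
  · rintro ⟨_, ⟨φ, r, rfl⟩, rfl⟩
    exact ⟨(ContinuousLinearMap.toUniformConvergenceCLM (RingHom.id ℝ) ℝ _ φ, r), rfl⟩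
  · rintro ⟨p, rfl⟩
    exact ⟨_, ⟨_, p.2, rfl⟩, rfl⟩

lemma continuous_sectionMap (k : Y) (e : (X →Lₚₜ[ℝ] Y) × Y) :
    Continuous (sectionMap (X := X) k e) := by
  refine Continuous.prodMk (PointwiseConvergenceCLM.continuous_of_continuous_eval fun x => ?_) ?_
  · have : Continuous fun p : (X →Lₚₜ[ℝ] ℝ) × ℝ => p.1 x :=
      (PointwiseConvergenceCLM.evalCLM (RingHom.id ℝ) ℝ x).continuous.comp continuous_fst
    exact (this.smul continuous_const).add continuous_const
  · exact (continuous_snd.smul continuous_const).add continuous_const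

lemma sectionMap_combo (k : Y) (e : (X →Lₚₜ[ℝ] Y) × Y) (p q : (X →Lₚₜ[ℝ] ℝ) × ℝ) {a b : ℝ}
    (hab : a + b = 1) :
    sectionMap k e (a • p + b • q) = a • sectionMap k e p + b • sectionMap k e q := by
  obtain rfl : b = 1 - a := by linarith
  refine Prod.ext (DFunLike.ext _ _ fun x => ?_) ?_
  · change (a * p.1 x + (1 - a) * q.1 x) • k + e.1 x =
      a • (p.1 x • k + e.1 x) + (1 - a) • (q.1 x • k + e.1 x)
    module
  · change (a * p.2 + (1 - a) * q.2) • k + e.2 =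
      a • (p.2 • k + e.2) + (1 - a) • (q.2 • k + e.2)
    module

lemma sectionallyConvex_iff {k : Y} {M : Set ((X →Lₚₜ[ℝ] Y) × Y)} :
    SectionallyConvex (kSubspace X k) M ↔ ∀ e, Convex ℝ (sectionMap k e ⁻¹' M) := by
  refine forall_congr' fun e => ?_
  rw [image_add_kSubspace]
  constructor
  · intro h p hp q hq a b ha hb hab
    rw [Set.mem_preimage, sectionMap_combo k e p q hab]
    exact (h ⟨hp, p, rfl⟩ ⟨hq, q, rfl⟩ ha hb hab).1
  · rintro h _ ⟨hp, p, rfl⟩ _ ⟨hq, q, rfl⟩ a b ha hb hab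
    rw [← sectionMap_combo k e p q hab]
    exact ⟨h hp hq ha hb hab, _, rfl⟩

/-- The part of a section lying in `N` has its closed convex hull inside the closure of the
sectionally convex hull of `N`. -/
lemma sectionMap_mem_closure_sco {k : Y} {e : (X →Lₚₜ[ℝ] Y) × Y}
    {N : Set ((X →Lₚₜ[ℝ] Y) × Y)} {N₀ : Set ((X →Lₚₜ[ℝ] ℝ) × ℝ)}
    (hN : ∀ p ∈ N₀, sectionMap k e p ∈ N) {p : (X →Lₚₜ[ℝ] ℝ) × ℝ}
    (hp : p ∈ closure (convexHull ℝ N₀)) :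
    sectionMap k e p ∈ closure (sco (kSubspace X k) N) := by
  refine map_mem_closure (continuous_sectionMap k e) hp fun q hq => ?_
  rintro M ⟨hM, hNM⟩
  have hsub : N₀ ⊆ sectionMap k e ⁻¹' M := fun r hr => hNM (hN r hr)
  exact convexHull_min hsub (sectionallyConvex_iff.1 hM e) hq

/-- On a section, each constraint involves only the scalar p(x) - r multiplying k. The scalars
landing in int K form an up-set because k ∈ K, so the admissible ones form a down-set of ℝ, which is
convex. -/
lemma sectionallyConvex_feasEpiConj {k : Y} (hk : k ∈ K) :
    SectionallyConvex (kSubspace X k) (feasEpiConj K S C F G) := by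
  have key : ∀ (w : Y) (s t : ℝ), s ≤ t → s • k + w ∈ interior (K : Set Y) →
      t • k + w ∈ interior (K : Set Y) := by
    intro w s t hst h
    convert add_mem_interior_cone (K.smul_mem hk (sub_nonneg.2 hst)) h using 1
    module
  refine sectionallyConvex_iff.2 fun e p hp q hq a b ha hb hab x hx c hc hmem => ?_
  have hp' := hp x hx c hc
  have hq' := hq x hx c hc
  have hrw : ∀ r : (X →Lₚₜ[ℝ] ℝ) × ℝ, (sectionMap k e r).1 x - c - (sectionMap k e r).2 =
      (r.1 x - r.2) • k + (e.1 x - c - e.2) := by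
    intro r
    rw [sectionMap_fst_apply, sectionMap_snd]
    module
  rw [hrw] at hp' hq' hmem
  have hval : (a • p + b • q).1 x - (a • p + b • q).2 =
      a * (p.1 x - p.2) + b * (q.1 x - q.2) := by
    change (a * p.1 x + b * q.1 x) - (a * p.2 + b * q.2) = _
    ring
  rw [hval] at hmem
  obtain rfl : b = 1 - a := by linarith
  rcases le_total (p.1 x - p.2) (q.1 x - q.2) with h | h
  · exact hq' (key _ _ _ (by nlinarith) hmem)
  · exact hp' (key _ _ _ (by nlinarith) hmem)

lemma isClosed_feasEpiConj : IsClosed (feasEpiConj (X := X) K S C F G) := by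
  simp only [feasEpiConj, Set.ofPred_forall]
  refine isClosed_iInter fun x => isClosed_iInter fun _ => isClosed_iInter fun a =>
    isClosed_iInter fun _ => ?_
  have h1 : Continuous fun p : (X →Lₚₜ[ℝ] Y) × Y => p.1 x :=
    (PointwiseConvergenceCLM.evalCLM (RingHom.id ℝ) Y x).continuous.comp continuous_fst
  have h2 : Continuous fun p : (X →Lₚₜ[ℝ] Y) × Y => p.1 x - a - p.2 :=
    (h1.sub continuous_const).sub continuous_snd
  exact (isOpen_interior.preimage h2).isClosed_compl

/-- Representation of `epi (F + I_A)^*` by the Lagrangian qualifying set. -/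
theorem feasEpiConj_subset_closure_sco [Nonempty U] (hP : ProperData S C F G)
    (hH : ConvexData K S C F G)
    {k : Y} (hk : k ∈ interior (K : Set Y)) :
    feasEpiConj K S C F G ⊆ closure (sco (kSubspace X k) (qualA K S C F G)) := by
  rintro ⟨L, y⟩ hL
  obtain ⟨φ, hφ, hφk, hφL⟩ := exists_scalarization hP hH hk hL
  have hφ0 : φ ≠ 0 := by
    rintro rfl
    simp at hφk
  set φL : X →Lₚₜ[ℝ] ℝ := PointwiseConvergenceCLM.postcomp X φ L
  have hφLx : ∀ x, φL x = φ (L x) := fun x => rfl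
  -- The translate is chosen so that the section passes through (L, y) at the parameter (φ ∘ L, φ
  -- y); as φ(k) = 1, φ annihilates both components of e.
  set e : (X →Lₚₜ[ℝ] Y) × Y := (L, y) - sectionMap k 0 (φL, φ y) with he
  have hΦ : sectionMap k e (φL, φ y) = (L, y) := by
    have : ∀ p, sectionMap k e p = sectionMap k 0 p + e := fun p => by simp [sectionMap]
    rw [this, he, add_sub_cancel]
  have he1 : ∀ x, e.1 x = L x - φ (L x) • k := fun x => by
    have h := DFunLike.congr_fun (congrArg Prod.fst hΦ) x
    rw [sectionMap_fst_apply] at h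
    exact eq_sub_of_add_eq' h
  have he2 : e.2 = y - φ y • k := by
    have h := congrArg Prod.snd hΦ
    rw [sectionMap_snd] at h
    exact eq_sub_of_add_eq' h
  rw [← hΦ]
  obtain ⟨x₀, hx₀, a₀, ha₀⟩ := hP.exists_feasible
  -- Epigraph of the perturbation function: φ ∘ F restricted to x ∈ C and G_u(x) ≤ z. Its trace at z
  -- = 0, over all u, is the scalarized problem on A.
  set Q : U → Set ((X × Z) × ℝ) := fun u =>
    {p | p.1.1 ∈ C ∧ p.1 ∈ epi S (G u) ∧ ∃ a : Y, F p.1.1 = a ∧ φ a ≤ p.2} with hQ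
  have hmem₀ : ∀ u, ∀ s ∈ S, ((x₀, s), φ a₀) ∈ Q u := by
    intro u s hs
    obtain ⟨s', hs', hG⟩ := hx₀.2 u
    refine ⟨hx₀.1, mem_epi_iff.2 ⟨_, hG, ?_⟩, a₀, ha₀, le_rfl⟩
    simpa using S.add_mem hs hs'
  refine sectionMap_mem_closure_sco ?_
    (mem_closure_convexHull_minorants (Q := Q) (x₀ := x₀) (t₀ := φ a₀) (s₀ := φ a₀ - 1)
      ?_ ?_ ?_ (fun u => hmem₀ u 0 S.zero_mem) ?_ ?_)
  · rintro ⟨ψ, r⟩ ⟨u, ζ, hζ⟩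
    dsimp only at hζ
    -- Since z may move along S within Q u, boundedness forces ζ ≤ 0 on S, so -ζ k is a positive
    -- operator.
    refine (mem_qualA_iff hP ⟨k, hk⟩).2 ⟨kmul k (-ζ), fun s hs => ?_, u, ?_⟩
    · rw [kmul_apply]
      refine K.smul_mem (interior_subset hk) ?_
      rw [_root_.neg_apply, neg_nonneg]
      by_contra! hpos
      set n := |r - ψ x₀ + φ a₀| + 1 with hn
      have h1 := hζ x₀ _ _ (hmem₀ u ((n / ζ s) • s) (S.smul_mem hs (by positivity)))
      rw [map_smul, smul_eq_mul, div_mul_cancel₀ _ hpos.ne'] at h1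
      linarith [le_abs_self (r - ψ x₀ + φ a₀)]
    · intro x hx a z ha hz hmem
      have h1 := hζ x z (φ a) ⟨hx, mem_epi_iff.2 ⟨z, hz, by simp⟩, a, ha, le_rfl⟩
      -- Applying φ removes e and leaves ψ x + ζ z - φ a - r > 0, against `hζ`.
      have h2 := pos_of_mem_interior hφ hφ0 hmem
      have h3 : (sectionMap k e (ψ, r)).1 x = ψ x • k + (L x - φ (L x) • k) := by
        rw [sectionMap_fst_apply, he1]
      have h4 : (sectionMap k e (ψ, r)).2 = r • k + (y - φ y • k) := by
        rw [sectionMap_snd, he2]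
      change 0 < φ ((sectionMap k e (ψ, r)).1 x - (a + kmul k (-ζ) z) -
        (sectionMap k e (ψ, r)).2) at h2
      rw [h3, h4, kmul_apply] at h2
      simp only [map_sub, map_add, map_smul, hφk, smul_eq_mul,
        _root_.neg_apply] at h2
      linarith
  · intro u
    refine (hH.convex_C.linear_preimage
      (LinearMap.fst ℝ X Z ∘ₗ LinearMap.fst ℝ (X × Z) ℝ)).inter
      (((hH.convex_G u).linear_preimage (LinearMap.fst ℝ (X × Z) ℝ)).inter
      ((convex_scalarEpigraph hH.convex_F hφ).linear_preimage
        ((LinearMap.fst ℝ X Z ∘ₗ LinearMap.fst ℝ (X × Z) ℝ).prod (LinearMap.snd ℝ (X × Z) ℝ))))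
  · intro u
    have hcl : IsClosed {p : X × ℝ | ∃ a : Y, F p.1 = a ∧ φ a ≤ p.2} := by
      have h1 := (hH.lsc_F φ hφ hφ0).isClosed_epigraph
      have h2 : Continuous fun p : X × ℝ => (p.1, (p.2 : EReal)) :=
        continuous_fst.prodMk (continuous_coe_real_ereal.comp continuous_snd)
      convert h1.preimage h2 using 1
      ext p
      exact (toEReal_le_iff (hP.ne_negInf_F p.1)).symm
    exact (hH.closed_C.preimage (continuous_fst.comp continuous_fst)).inter
      (((hH.epiClosed_G u).preimage continuous_fst).inter
      (hcl.preimage ((continuous_fst.comp continuous_fst).prodMk continuous_snd)))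
  · rintro u p t t' ⟨h1, h2, a, ha, hat⟩ htt
    exact ⟨h1, h2, a, ha, hat.trans htt⟩
  · rintro u ⟨-, -, a, ha, hat⟩
    dsimp only at ha hat
    rw [ha₀] at ha
    obtain rfl := Ext.fin_injective ha
    linarith
  · intro x t hx
    have hfeas : x ∈ feasible S C G :=
      mem_feasible_iff.2 ⟨(hx (Classical.arbitrary U)).1, fun u => (hx u).2.1⟩
    obtain ⟨-, -, a, ha, hat⟩ := hx (Classical.arbitrary U)
    have := hφL x hfeas a ha
    dsimp only at hat
    rw [hφLx]
    linarith

/-- For a set between the Lagrangian qualifying set and `epi (F + I_A)^*`, the closedness condition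
means that it agrees with the latter set on `V`. -/
theorem sectionallyConvexClosedRegarding_iff [Nonempty U] (hP : ProperData S C F G)
    (hH : ConvexData K S C F G)
    {k : Y} (hk : k ∈ interior (K : Set Y)) {N : Set ((X →Lₚₜ[ℝ] Y) × Y)}
    (hAN : qualA K S C F G ⊆ N) (hN : N ⊆ feasEpiConj K S C F G) (V : Set (X →Lₚₜ[ℝ] Y)) :
    SectionallyConvexClosedRegarding k N (V ×ˢ (Set.univ : Set Y)) ↔
      ∀ L ∈ V, ∀ y, (L, y) ∈ feasEpiConj K S C F G → (L, y) ∈ N := by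
  -- N is squeezed between 𝒜, whose closed hull is already everything, and a closed sectionally
  -- convex set.
  have hcl : closure (sco (kSubspace X k) N) = feasEpiConj K S C F G := by
    refine Set.Subset.antisymm (closure_minimal ?_ isClosed_feasEpiConj) ?_
    · exact Set.sInter_subset_of_mem ⟨sectionallyConvex_feasEpiConj (interior_subset hk), hN⟩
    · refine (feasEpiConj_subset_closure_sco hP hH hk).trans (closure_mono ?_)
      exact Set.sInter_subset_sInter fun M hM => ⟨hM.1, hAN.trans hM.2⟩
  rw [SectionallyConvexClosedRegarding, hcl]
  constructor
  · intro h L hL y hy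
    exact (h.subset ⟨hy, hL, trivial⟩).1
  · intro h
    refine Set.Subset.antisymm ?_ (Set.inter_subset_inter_left _ hN)
    rintro ⟨L, y⟩ ⟨hy, hL, -⟩
    exact ⟨h L hL y hy, hL, trivial⟩

end Hull

end

end RobustVector

/-! ### Conclusion -/

namespace RobustVector

variable {X Y Z U : Type*}
  [AddCommGroup X] [Module ℝ X] [TopologicalSpace X]
  [AddCommGroup Y] [Module ℝ Y] [TopologicalSpace Y] [IsTopologicalAddGroup Y]
  [AddCommGroup Z] [Module ℝ Z] [TopologicalSpace Z]
  {S : ProperCone ℝ Z} {C : Set X} {F : X → Ext Y} {G : U → X → Ext Z}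

lemma IsProper.properData (hF : IsProper F) (hG : ∀ u, IsProper (G u))
    (hfeas : (feasible S C G ∩ dom F).Nonempty) : ProperData S C F G := by
  refine ⟨hF.2, fun u => (hG u).2, ?_⟩
  obtain ⟨x, hx, hdom⟩ := hfeas
  refine ⟨x, hx, ?_⟩
  rcases h : F x with _ | a | _
  · exact (hF.2 x h).elim
  · exact ⟨a, rfl⟩
  · exact (hdom h).elim

end RobustVector

theorem theorem6p2 {X Y Z U : Type*}
    [AddCommGroup X] [Module ℝ X] [TopologicalSpace X] [IsTopologicalAddGroup X]
    [ContinuousSMul ℝ X] [LocallyConvexSpace ℝ X] [T2Space X]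
    [AddCommGroup Y] [Module ℝ Y] [TopologicalSpace Y] [IsTopologicalAddGroup Y]
    [ContinuousSMul ℝ Y] [LocallyConvexSpace ℝ Y] [T2Space Y]
    [AddCommGroup Z] [Module ℝ Z] [TopologicalSpace Z] [IsTopologicalAddGroup Z]
    [ContinuousSMul ℝ Z] [LocallyConvexSpace ℝ Z] [T2Space Z]
    [Nonempty U]
    (K : ProperCone ℝ Y) (hK : (K : Set Y) ≠ Set.univ) (hKint : (interior (K : Set Y)).Nonempty)
    (S : ProperCone ℝ Z) (C : Set X) (F : X → RobustVector.Ext Y) (G : U → X → RobustVector.Ext Z)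
    (hF : RobustVector.IsProper F) (hG : ∀ u, RobustVector.IsProper (G u))
    (hfeas : (RobustVector.feasible S C G ∩ RobustVector.dom F).Nonempty)
    (V : Set (X →Lₚₜ[ℝ] Y)) (hV : V.Nonempty)
    (hH : RobustVector.ConvexData K S C F G) :
    ((∃ k ∈ interior (K : Set Y),
        RobustVector.SectionallyConvexClosedRegarding k
          (RobustVector.qualA K S C F G) (V ×ˢ (Set.univ : Set Y))) ↔
      RobustVector.StrongStableDuality K S C F G V) ∧
    ((∃ k ∈ interior (K : Set Y),
        RobustVector.SectionallyConvexClosedRegarding k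
          (RobustVector.qualB K S C F G) (V ×ˢ (Set.univ : Set Y))) ↔
      RobustVector.WeakStrongStableDuality K S C F G V) := by
  have hP := hF.properData hG hfeas
  have hAB := RobustVector.qualA_subset_qualB hP hK hKint
  have hB := RobustVector.qualB_subset_feasEpiConj hP hKint
  rw [RobustVector.strongStableDuality_iff hP hKint,
    RobustVector.weakStrongStableDuality_iff hP hK hKint]
  constructor
  · constructor
    · rintro ⟨k, hk, h⟩
      exact (RobustVector.sectionallyConvexClosedRegarding_iff hP hH hk subset_rfl
        (hAB.trans hB) V).1 h
    · intro h
      -- Any interior k serves, as the criterion on the duality side does not involve k.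
      obtain ⟨k, hk⟩ := hKint
      exact ⟨k, hk, (RobustVector.sectionallyConvexClosedRegarding_iff hP hH hk subset_rfl
        (hAB.trans hB) V).2 h⟩
  · constructor
    · rintro ⟨k, hk, h⟩
      exact (RobustVector.sectionallyConvexClosedRegarding_iff hP hH hk hAB hB V).1 h
    · intro h
      obtain ⟨k, hk⟩ := hKint
      exact ⟨k, hk,
        (RobustVector.sectionallyConvexClosedRegarding_iff hP hH hk hAB hB V).2 h⟩
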